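/- Let $b\ge 2$ be an integer. For an integer $n\ge 1$ with base-$b$ expansion $n=\sum_{0\le i<N}n_ib^i$, where $0\le n_i<b$ and $n_{N-1}\ne 0$, write $\overleftarrow{n}=\sum_{0\le i<N}n_ib^{N-1-i}$ for its digital reverse. For real $x>0$ let $$\mathscr P_b^*(x)=\{1\le n\le x:\ b\nmid n,\ n=\overleftarrow{n},\ \gcd(n,b^3-b)=1\}$$ be the set of base-$b$ palindromes up to $x$ that are coprime to $b^3-b$, and for real $D>0$ let $$S_b(x,D)=\#\{n\in\mathscr P_b^*(x):\ \exists\, d\in\mathbb Z\cap[D,2D]\ \text{with}\ d^2\mid n\}.$$ (1) For every $\varepsilon>0$ there is a constant $C=C(b,\varepsilon)>0$ such that for all real $x>0$ and $D$ with $x^{1/4}\le D\le x^{2/5}$, $$S_b(x,D)\le C\,\frac{x^{2/3}}{D^{2/3-\varepsilon}}.$$ (2) In particular, for every $\varepsilon\in(0,1/4)$ there is a constant $C=C(b,\varepsilon)>0$ such that for all real $x>0$ and $D$ with $x^{1/4+3\varepsilon}\le D\le x^{2/5}$, $$S_b(x,D)\le C\,x^{1/2-\varepsilon}.$$ -/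

import Mathlib

noncomputable section

namespace SqfreePalin

/-- The digital reverse of `n` in base `b`: if `n = ∑_{0 ≤ i < N} n_i b^i` is the base-`b` expansion
(with nonzero leading digit), this is `∑_{0 ≤ i < N} n_i b^(N-1-i)`. -/
def rev (b n : ℕ) : ℕ := Nat.ofDigits b (Nat.digits b n).reverse

/-- The base-`b` palindromes: `n ≥ 0` not divisible by `b` and equal to its digital reverse. -/
def palindromes (b : ℕ) : Set ℕ := {n | ¬ b ∣ n ∧ n = rev b n}

/-- The base-`b` palindromes `n ≤ x` with `gcd(n, b³ - b) = 1`. -/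
def palindromesStar (b : ℕ) (x : ℝ) : Set ℕ :=
  {n | n ∈ palindromes b ∧ (n : ℝ) ≤ x ∧ Nat.Coprime n (b ^ 3 - b)}

/-- The restricted palindromes `n ≤ x` divisible by `d²` for some integer `d ∈ [D, 2D]`. -/
def squareDivSet (b : ℕ) (x D : ℝ) : Set ℕ :=
  {n | n ∈ palindromesStar b x ∧ ∃ d : ℕ, (d : ℝ) ∈ Set.Icc D (2 * D) ∧ d ^ 2 ∣ n}

/-- The set counted by `S` is finite, so that its `Set.ncard` is its true cardinality. -/
theorem squareDivSet_finite (b : ℕ) (x D : ℝ) : (squareDivSet b x D).Finite :=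
  (Set.finite_Iic ⌊x⌋₊).subset fun _ hn => Nat.le_floor hn.1.2.1

/-- `S_b(x, D)`: the number of restricted palindromes `n ≤ x` divisible by `d²` for some
integer `d ∈ [D, 2D]`. -/
def S (b : ℕ) (x D : ℝ) : ℕ := (squareDivSet b x D).ncard

end SqfreePalin

end

/-! Take `q = b ^ j` with `q ^ 6` equal to `x / D` up to a constant factor. The leading `2j` digits
of a palindrome also fix its last `2j` digits. Sorting palindromes by length and by these digits
therefore gives O(log x) · q² groups, and inside one group the numbers agree modulo q² and differ by
at most bx/q². It suffices to find O(q²) members per group, up to logarithms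
(`card_le_of_close_of_modEq`): the total is then about q⁴, that is, (x/D)^(2/3).

In one group write n = d²m. Few n share the same d, so the moduli d are counted, knowing that d²m is
almost constant both in absolute value and modulo q² (`NearSquares`). Cut [D, 2D] into residue
classes modulo q and intervals of length D/q, about 2q² cells. A cell with several moduli contains a
close pair d, d + qt, whose cofactors are m, m + qs. Expanding to first order, ds + 2mt is O(q³) and
divisible by q (`exists_step`). Multiplying by d² and using the near constancy of d²m, differences
of s·d³ are small for both metrics. Few cells can thus have the same step (t, s) (`card_step_le`),
while a cell with step (t, s) holds at most 1 + D/(q²t) moduli. Summing over steps gives q² times a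
divisor count and two harmonic sums (`card_le_of_large`).

The argument needs s ≠ 0, which holds once m > bq². Smaller cofactors are fixed one at a time
(`card_le_of_small`). The divisor count of b^j and the harmonic sums are powers of log x, absorbed
by D^ε. -/

namespace SqfreePalin

open Finset

/-! ### Pigeonhole for separated families -/

/-- A finite family of reals that is `δ`-separated and spreads over at most `W` has at most
`W / δ + 1` members. -/
theorem card_le_of_separated {α : Type*} (F : Finset α) (f : α → ℝ) {δ W : ℝ} (hδ : 0 < δ)
    (hW : 0 ≤ W) (hsep : ∀ u ∈ F, ∀ v ∈ F, u ≠ v → δ ≤ |f u - f v|)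
    (hwid : ∀ u ∈ F, ∀ v ∈ F, f u - f v ≤ W) : (F.card : ℝ) ≤ W / δ + 1 := by
  classical
  rcases F.eq_empty_or_nonempty with rfl | hne
  · simp only [card_empty, Nat.cast_zero]; positivity
  obtain ⟨u₀, hu₀, hmin⟩ := exists_min_image F f hne
  have hcard : F.card ≤ (range (⌊W / δ⌋₊ + 1)).card := by
    refine card_le_card_of_injOn (fun u => ⌊(f u - f u₀) / δ⌋₊) ?_ ?_
    · intro u hu
      simp only [coe_range, Set.mem_Iio]
      exact Nat.lt_succ_of_le
        (Nat.floor_le_floor (div_le_div_of_nonneg_right (hwid u hu u₀ hu₀) hδ.le))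
    · intro u hu v hv huv
      by_contra hne
      have h0 : ∀ w ∈ F, 0 ≤ (f w - f u₀) / δ := fun w hw =>
        div_nonneg (sub_nonneg.2 (hmin w hw)) hδ.le
      have h1 := Nat.floor_le (h0 u hu)
      have h2 := Nat.lt_floor_add_one ((f u - f u₀) / δ)
      have h3 := Nat.floor_le (h0 v hv)
      have h4 := Nat.lt_floor_add_one ((f v - f u₀) / δ)
      simp only at huv
      rw [huv] at h1 h2
      have h5 : |(f u - f u₀) / δ - (f v - f u₀) / δ| < 1 := by
        rw [abs_lt]; constructor <;> linarith
      have h6 : (f u - f u₀) / δ - (f v - f u₀) / δ = (f u - f v) / δ := by ring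
      rw [h6, abs_div, abs_of_pos hδ, div_lt_one hδ] at h5
      exact absurd (hsep u hu v hv hne) (not_le.2 h5)
  rw [card_range] at hcard
  calc (F.card : ℝ) ≤ ((⌊W / δ⌋₊ + 1 : ℕ) : ℝ) := by exact_mod_cast hcard
    _ ≤ W / δ + 1 := by
      push_cast
      gcongr
      exact Nat.floor_le (by positivity)

/-- Among at least two integers in an interval of length `W` some two are at distance at most
`W / (card - 1)`. -/
theorem exists_close_pair (F : Finset ℕ) (hF : 2 ≤ F.card) {W : ℝ}
    (hwid : ∀ u ∈ F, ∀ v ∈ F, (u : ℝ) - v ≤ W) :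
    ∃ u ∈ F, ∃ v ∈ F, u < v ∧ ((v : ℝ) - u) * ((F.card : ℝ) - 1) ≤ W := by
  classical
  have hne : ((F ×ˢ F).filter fun p => p.1 < p.2).Nonempty := by
    obtain ⟨a, ha, b, hb, hab⟩ := one_lt_card.1 hF
    rcases lt_or_gt_of_ne hab with h | h
    · exact ⟨(a, b), by simp [ha, hb, h]⟩
    · exact ⟨(b, a), by simp [ha, hb, h]⟩
  obtain ⟨⟨u, v⟩, huv, hmin⟩ :=
    exists_min_image _ (fun p : ℕ × ℕ => (p.2 : ℝ) - p.1) hne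
  simp only [mem_filter, mem_product] at huv hmin
  obtain ⟨⟨hu, hv⟩, hlt⟩ := huv
  have hpos : (0 : ℝ) < (v : ℝ) - u := sub_pos.2 (by exact_mod_cast hlt)
  refine ⟨u, hu, v, hv, hlt, ?_⟩
  -- The minimal gap is itself a separation constant for the whole family.
  have := card_le_of_separated F (fun n : ℕ => (n : ℝ)) hpos (hpos.le.trans (hwid v hv u hu))
    (fun a ha c hc hac => by
      rcases lt_or_gt_of_ne hac with h | h
      · rw [abs_sub_comm]
        exact (hmin (a, c) ⟨⟨ha, hc⟩, h⟩).trans (le_abs_self _)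
      · exact (hmin (c, a) ⟨⟨hc, ha⟩, h⟩).trans (le_abs_self _)) hwid
  have h2 : (F.card : ℝ) - 1 ≤ W / ((v : ℝ) - u) := by linarith
  rw [le_div_iff₀ hpos] at h2
  linarith

/-! ### Weighted sums of greatest common divisors -/

/-- The gcd is one of the common divisors of q and s, so it is at most the sum of all of them;
exchanging the two sums leaves one sum over multiples of g for each divisor g of q. -/
theorem sum_gcd_mul_le (q R : ℕ) (hq : 0 < q) (f : ℕ → ℝ) (hf : ∀ n, 0 ≤ f n) {B : ℝ}
    (hB : ∀ g ∈ q.divisors, (g : ℝ) * ∑ s ∈ (Icc 1 R).filter (g ∣ ·), f s ≤ B) :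
    ∑ s ∈ Icc 1 R, (Nat.gcd q s : ℝ) * f s ≤ q.divisors.card * B := by
  calc ∑ s ∈ Icc 1 R, (Nat.gcd q s : ℝ) * f s
      ≤ ∑ s ∈ Icc 1 R, ∑ g ∈ q.divisors, if g ∣ s then (g : ℝ) * f s else 0 := by
        refine sum_le_sum fun s _ => ?_
        have := single_le_sum (s := q.divisors)
          (f := fun g => if g ∣ s then (g : ℝ) * f s else 0)
          (fun g _ => by split_ifs <;> [exact mul_nonneg (Nat.cast_nonneg _) (hf s); exact le_rfl])
          (Nat.mem_divisors.2 ⟨Nat.gcd_dvd_left q s, hq.ne'⟩)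
        simpa [Nat.gcd_dvd_right] using this
    _ = ∑ g ∈ q.divisors, (g : ℝ) * ∑ s ∈ (Icc 1 R).filter (g ∣ ·), f s := by
        rw [sum_comm]
        refine sum_congr rfl fun g _ => ?_
        rw [mul_sum, sum_filter]
    _ ≤ ∑ g ∈ q.divisors, B := sum_le_sum hB
    _ = _ := by simp

theorem sum_gcd_le (q R : ℕ) (hq : 0 < q) :
    ∑ s ∈ Icc 1 R, (Nat.gcd q s : ℝ) ≤ q.divisors.card * (R : ℝ) := by
  have := sum_gcd_mul_le q R hq (fun _ => 1) (fun _ => zero_le_one) (B := R) (fun g hg => by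
    rw [sum_const, nsmul_eq_mul, mul_one]
    have h : ((Icc 1 R).filter (g ∣ ·)).card = R / g := Nat.Ioc_filter_dvd_card_eq_div R g
    rw [h]
    exact_mod_cast Nat.mul_div_le R g)
  simpa using this

theorem sum_gcd_div_le (q R : ℕ) (hq : 0 < q) :
    ∑ s ∈ Icc 1 R, (Nat.gcd q s : ℝ) * (s : ℝ)⁻¹ ≤
      q.divisors.card * ∑ s ∈ Icc 1 R, (s : ℝ)⁻¹ := by
  refine sum_gcd_mul_le q R hq (fun s => (s : ℝ)⁻¹) (fun s => by positivity) fun g hg => ?_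
  have hg0 : 0 < g := Nat.pos_of_mem_divisors hg
  calc (g : ℝ) * ∑ s ∈ (Icc 1 R).filter (g ∣ ·), (s : ℝ)⁻¹
      = ∑ s ∈ (Icc 1 R).filter (g ∣ ·), ((s / g : ℕ) : ℝ)⁻¹ := by
        rw [mul_sum]
        refine sum_congr rfl fun s hs => ?_
        obtain ⟨k, rfl⟩ := (mem_filter.1 hs).2
        rw [Nat.mul_div_cancel_left _ hg0]
        push_cast
        field_simp
    _ = ∑ k ∈ ((Icc 1 R).filter (g ∣ ·)).image (· / g), (k : ℝ)⁻¹ := by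
        rw [sum_image]
        intro s hs t ht hst
        obtain ⟨k, rfl⟩ := (mem_filter.1 hs).2
        obtain ⟨l, rfl⟩ := (mem_filter.1 ht).2
        simp only [Nat.mul_div_cancel_left _ hg0] at hst
        rw [hst]
    _ ≤ ∑ s ∈ Icc 1 R, (s : ℝ)⁻¹ := by
        refine sum_le_sum_of_subset_of_nonneg ?_ fun _ _ _ => by positivity
        intro k hk
        obtain ⟨s, hs, rfl⟩ := mem_image.1 hk
        obtain ⟨hs, k, rfl⟩ := mem_filter.1 hs
        rw [mem_Icc] at hs ⊢
        rw [Nat.mul_div_cancel_left _ hg0]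
        refine ⟨Nat.pos_of_ne_zero ?_, ?_⟩
        · rintro rfl; simp at hs
        · exact (Nat.le_mul_of_pos_left k hg0).trans hs.2

/-! ### Palindromes modulo powers of the base -/

/-- In base `b`, the last `k` digits of a palindrome with at least `k` digits are determined by
its first `k` digits. -/
theorem palindromes_mod_pow {b : ℕ} (hb : 2 ≤ b) {n : ℕ} (hn : n ∈ palindromes b) {k : ℕ}
    (hk : k ≤ (Nat.digits b n).length) :
    n % b ^ k = rev b (n / b ^ ((Nat.digits b n).length - k)) := by
  obtain ⟨hdvd, hrev⟩ := hn
  have hn0 : n ≠ 0 := by rintro rfl; exact hdvd (dvd_zero b)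
  set l := Nat.digits b n with hl
  have h1 : n % b ^ k = Nat.ofDigits b (l.reverse.take k) := by
    conv_lhs => rw [hrev, rev]
    exact Nat.ofDigits_mod_pow_eq_ofDigits_take k (by omega) _ fun d hd =>
      Nat.digits_lt_base (by omega) (List.mem_reverse.1 hd)
  have h2 : Nat.digits b (n / b ^ (l.length - k)) = l.drop (l.length - k) := by
    rw [Nat.self_div_pow_eq_ofDigits_drop _ _ hb]
    refine Nat.digits_ofDigits b (by omega) _ (fun d hd =>
      Nat.digits_lt_base (by omega) (List.mem_of_mem_drop hd)) fun h => ?_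
    rw [List.getLast_drop]
    exact Nat.getLast_digit_ne_zero b hn0
  rw [h1, rev, h2, List.take_reverse]

/-! ### First-order expansion of d²m, modulo q² and over the reals -/

/-- The first-order term of the expansion is q·d·(ds + 2mt), and everything else is divisible by q².
Cancel q, then the unit d. -/
theorem dvd_linear_form {q d m t s : ℤ} (hq : q ≠ 0) (hd : IsCoprime q d)
    (h : q ^ 2 ∣ (d + q * t) ^ 2 * (m + q * s) - d ^ 2 * m) : q ∣ d * s + 2 * m * t := by
  have h1 : (d + q * t) ^ 2 * (m + q * s) - d ^ 2 * m =
      q * (d * (d * s + 2 * m * t)) + q ^ 2 * (2 * d * t * s + m * t ^ 2 + q * t ^ 2 * s) := by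
    ring
  rw [h1, dvd_add_left (dvd_mul_right _ _), pow_two] at h
  exact hd.dvd_of_dvd_mul_left (Int.dvd_of_mul_dvd_mul_left hq h)

/-- Modulo q both d² and d²m are unchanged and d is a unit. This makes the difference of cofactors a
multiple qs. -/
theorem dvd_cofactor_sub {q d d' m m' : ℤ} (hd : IsCoprime q d) (h1 : q ∣ d' - d)
    (h2 : q ∣ d' ^ 2 * m' - d ^ 2 * m) : q ∣ m' - m := by
  have h3 : q ∣ d ^ 2 * (m' - m) := by
    have : d ^ 2 * (m' - m) = (d' ^ 2 * m' - d ^ 2 * m) - (d' - d) * ((d' + d) * m') := by ring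
    rw [this]
    exact dvd_sub h2 (Dvd.dvd.mul_right h1 _)
  exact (hd.pow_right (n := 2)).dvd_of_dvd_mul_left h3

/-- If `d² m` and `(d + h)² (m + u)` are close, then `d u + 2 m h` is small. -/
theorem abs_linear_form_le {D d h m u q B x : ℝ} (hD : 0 < D) (hd : D ≤ d) (hdh : d + h ≤ 2 * D)
    (hh : 0 ≤ h) (hm : 0 ≤ m) (hmx : m * D ^ 2 ≤ x) (hq : 0 < q) (hhq : h * q ≤ D)
    (hΔ : |(d + h) ^ 2 * (m + u) - d ^ 2 * m| * q ^ 2 ≤ B * x) :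
    |d * u + 2 * m * h| * (q ^ 2 * D) ≤ (2 * B + 9) * x := by
  set Δ := (d + h) ^ 2 * (m + u) - d ^ 2 * m with hΔdef
  have hd0 : 0 < d := hD.trans_le hd
  have h1 : (d + h) ^ 2 * |u| ≤ |Δ| + m * (h * (2 * d + h)) := by
    have e : (d + h) ^ 2 * u = Δ - m * (h * (2 * d + h)) := by rw [hΔdef]; ring
    calc (d + h) ^ 2 * |u| = |(d + h) ^ 2 * u| := by rw [abs_mul, abs_of_nonneg (sq_nonneg (d + h))]
      _ ≤ |Δ| + |m * (h * (2 * d + h))| := by rw [e]; exact abs_sub _ _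
      _ = _ := by rw [abs_of_nonneg (by positivity : 0 ≤ m * (h * (2 * d + h)))]
  -- The crude bound on u from `h1` is fed back to control the term u·h·(2d + h) of the expansion,
  -- so that only Δ and mh² remain.
  have h2 : |u| * (h * (2 * d + h)) ≤ |Δ| + 8 * m * h ^ 2 := by
    have hpos : 0 < (d + h) ^ 2 := by positivity
    have a1 : h * (2 * d + h) ≤ (d + h) ^ 2 := by nlinarith
    have a2 : (h * (2 * d + h)) * (h * (2 * d + h)) ≤ 8 * h ^ 2 * (d + h) ^ 2 := by
      have : (2 * d + h) * (2 * d + h) ≤ 8 * (d + h) ^ 2 := by nlinarith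
      calc (h * (2 * d + h)) * (h * (2 * d + h)) = h ^ 2 * ((2 * d + h) * (2 * d + h)) := by ring
        _ ≤ h ^ 2 * (8 * (d + h) ^ 2) := by gcongr
        _ = _ := by ring
    refine le_of_mul_le_mul_left ?_ hpos
    calc (d + h) ^ 2 * (|u| * (h * (2 * d + h)))
        = ((d + h) ^ 2 * |u|) * (h * (2 * d + h)) := by ring
      _ ≤ (|Δ| + m * (h * (2 * d + h))) * (h * (2 * d + h)) := by gcongr
      _ = |Δ| * (h * (2 * d + h)) + m * ((h * (2 * d + h)) * (h * (2 * d + h))) := by ring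
      _ ≤ |Δ| * (d + h) ^ 2 + m * (8 * h ^ 2 * (d + h) ^ 2) := by gcongr
      _ = _ := by ring
  have h3 : d * |d * u + 2 * m * h| ≤ 2 * |Δ| + 9 * m * h ^ 2 := by
    have e : d * (d * u + 2 * m * h) = Δ - (m * h ^ 2 + u * (h * (2 * d + h))) := by
      rw [hΔdef]; ring
    calc d * |d * u + 2 * m * h| = |d * (d * u + 2 * m * h)| := by
          rw [abs_mul, abs_of_pos hd0]
      _ ≤ |Δ| + |m * h ^ 2 + u * (h * (2 * d + h))| := by rw [e]; exact abs_sub _ _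
      _ ≤ |Δ| + (|m * h ^ 2| + |u * (h * (2 * d + h))|) := by gcongr; exact abs_add_le _ _
      _ = |Δ| + (m * h ^ 2 + |u| * (h * (2 * d + h))) := by
          rw [abs_mul u, abs_of_nonneg (by positivity : 0 ≤ m * h ^ 2),
            abs_of_nonneg (by positivity : 0 ≤ h * (2 * d + h))]
      _ ≤ _ := by linarith
  have h4 : m * h ^ 2 * q ^ 2 ≤ x := by
    calc m * h ^ 2 * q ^ 2 = m * (h * q) ^ 2 := by ring
      _ ≤ m * D ^ 2 := by gcongr
      _ ≤ x := hmx
  calc |d * u + 2 * m * h| * (q ^ 2 * D) = q ^ 2 * (D * |d * u + 2 * m * h|) := by ring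
    _ ≤ q ^ 2 * (d * |d * u + 2 * m * h|) := by gcongr
    _ ≤ q ^ 2 * (2 * |Δ| + 9 * m * h ^ 2) := by gcongr
    _ = 2 * (|Δ| * q ^ 2) + 9 * (m * h ^ 2 * q ^ 2) := by ring
    _ ≤ _ := by linarith

/-- For `d` coprime to `b` the cube `d³` modulo a divisor of a power of `b` nearly determines `d`. -/
theorem card_image_mod_le {b j : ℕ} (hb : 2 ≤ b) {s : ℤ} (E : Finset ℕ)
    (hco : ∀ d ∈ E, Nat.Coprime d b)
    (hE : ∀ d ∈ E, ∀ d' ∈ E, ((b ^ j : ℕ) : ℤ) ∣ s * ((d : ℤ) ^ 3 - (d' : ℤ) ^ 3)) :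
    ((E.image (· % b ^ j)).card : ℝ) ≤ 18 * b * Nat.gcd (b ^ j) s.natAbs := by
  classical
  set q := b ^ j with hq
  have hq0 : 0 < q := by positivity
  set g := Nat.gcd q (3 * s.natAbs) with hg
  have hg0 : 0 < g := Nat.gcd_pos_of_pos_left _ hq0
  have hgle : g ≤ 3 * Nat.gcd q s.natAbs :=
    (Nat.le_of_dvd (Nat.mul_pos (Nat.gcd_pos_of_pos_left _ hq0) (Nat.gcd_pos_of_pos_left _ hq0))
      (Nat.gcd_mul_right_dvd_mul_gcd q 3 s.natAbs)).trans
      (Nat.mul_le_mul_right _ (Nat.gcd_le_right _ (by norm_num)))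
  have hgq : g ∣ q := Nat.gcd_dvd_left _ _
  -- Within a class modulo 3b, d² + dd' + d'² is 3 times a number coprime to b. Hence q divides 3s(d
  -- − d'), the residues modulo q are spaced by q/g, and there are at most g + 1 ≤ 2g of them.
  have hclass : ∀ w ∈ range (3 * b),
      ((E.filter (· % (3 * b) = w)).image (· % q)).card ≤ 2 * g := by
    intro w _
    have hdvd : ∀ d ∈ E.filter (· % (3 * b) = w), ∀ d' ∈ E.filter (· % (3 * b) = w),
        ((q / g : ℕ) : ℤ) ∣ (d : ℤ) - d' := by
      intro d hd d' hd'
      rw [mem_filter] at hd hd'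
      have h1 : ((3 * b : ℕ) : ℤ) ∣ (d : ℤ) - d' :=
        (Nat.modEq_iff_dvd.1 (hd'.2.trans hd.2.symm : d' ≡ d [MOD 3 * b]))
      obtain ⟨k, hk⟩ := h1
      push_cast at hk
      have hfac : s * ((d : ℤ) ^ 3 - (d' : ℤ) ^ 3) =
          (3 * s * ((d : ℤ) - d')) * ((d' : ℤ) ^ 2 + b * (3 * k * d' + 3 * b * k ^ 2)) := by
        have : (d : ℤ) = d' + 3 * b * k := by linarith
        rw [this]; ring
      have hcop : IsCoprime ((q : ℕ) : ℤ) ((d' : ℤ) ^ 2 + b * (3 * k * d' + 3 * b * k ^ 2)) := by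
        rw [hq]; push_cast
        apply IsCoprime.pow_left
        rw [IsCoprime.add_mul_left_right_iff]
        apply IsCoprime.pow_right
        exact (Nat.isCoprime_iff_coprime.2 (hco d' hd'.1)).symm
      have h2 := hE d hd.1 d' hd'.1
      rw [hfac] at h2
      have h3 : (q : ℤ) ∣ 3 * s * ((d : ℤ) - d') := hcop.dvd_of_dvd_mul_right h2
      have h4 : q ∣ (3 * s.natAbs) * ((d : ℤ) - d').natAbs := by
        have := Int.natAbs_dvd_natAbs.2 h3
        simpa [Int.natAbs_mul] using this
      have h5 : q / g ∣ ((d : ℤ) - d').natAbs := by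
        have h6 : q / g ∣ (3 * s.natAbs / g) * ((d : ℤ) - d').natAbs := by
          obtain ⟨c, hc⟩ := h4
          refine ⟨c, ?_⟩
          apply Nat.eq_of_mul_eq_mul_left hg0
          rw [← mul_assoc, ← mul_assoc, Nat.mul_div_cancel' (Nat.gcd_dvd_right _ _),
            Nat.mul_div_cancel' hgq, hc]
        exact (Nat.coprime_div_gcd_div_gcd hg0).dvd_of_dvd_mul_left h6
      exact Int.natCast_dvd.2 h5
    have hqg : 0 < q / g := Nat.div_pos (Nat.le_of_dvd hq0 hgq) hg0
    have hqgR : ((q / g : ℕ) : ℝ) = (q : ℝ) / g := Nat.cast_div hgq (by positivity)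
    have := card_le_of_separated ((E.filter (· % (3 * b) = w)).image (· % q))
      (fun n : ℕ => (n : ℝ)) (δ := (q / g : ℕ)) (W := q) (by exact_mod_cast hqg) (by positivity)
      (fun u hu v hv huv => by
        obtain ⟨d, hd, rfl⟩ := mem_image.1 hu
        obtain ⟨d', hd', rfl⟩ := mem_image.1 hv
        have h1 : ((q / g : ℕ) : ℤ) ∣ ((d % q : ℕ) : ℤ) - ((d' % q : ℕ) : ℤ) := by
          have e : ((d % q : ℕ) : ℤ) - ((d' % q : ℕ) : ℤ) =
              ((d : ℤ) - d') - (q : ℤ) * ((d / q : ℕ) - (d' / q : ℕ) : ℤ) := by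
            have a := Nat.mod_add_div d q
            have a' := Nat.mod_add_div d' q
            zify at a a' ⊢
            linarith
          rw [e]
          refine dvd_sub (hdvd d hd d' hd') (Dvd.dvd.mul_right ?_ _)
          exact Int.natCast_dvd_natCast.2 (Nat.div_dvd_of_dvd hgq)
        have h2 : ((q / g : ℕ) : ℤ) ≤ |((d % q : ℕ) : ℤ) - ((d' % q : ℕ) : ℤ)| :=
          Int.le_of_dvd (abs_pos.2 (sub_ne_zero.2 (by exact_mod_cast huv)))
            ((dvd_abs _ _).2 h1)
        have h3 := (Int.cast_le (R := ℝ)).2 h2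
        simpa only [Int.cast_abs, Int.cast_sub, Int.cast_natCast] using h3)
      (fun u hu v hv => by
        obtain ⟨d, hd, rfl⟩ := mem_image.1 hu
        have : ((d % q : ℕ) : ℝ) ≤ q := by exact_mod_cast (Nat.mod_lt d hq0).le
        have : (0 : ℝ) ≤ v := Nat.cast_nonneg v
        linarith)
    rw [hqgR, div_div_cancel₀ (by positivity)] at this
    have h1 : ((1 : ℕ) : ℝ) ≤ g := by exact_mod_cast hg0
    push_cast at h1
    have h2 : (((E.filter (· % (3 * b) = w)).image (· % q)).card : ℝ) ≤ (2 * g : ℕ) := by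
      push_cast; linarith
    exact_mod_cast h2
  have hsub : E.image (· % q) ⊆
      (range (3 * b)).biUnion fun w => (E.filter (· % (3 * b) = w)).image (· % q) := by
    intro r hr
    obtain ⟨d, hd, rfl⟩ := mem_image.1 hr
    exact mem_biUnion.2 ⟨d % (3 * b), mem_range.2 (Nat.mod_lt _ (by omega)),
      mem_image_of_mem _ (mem_filter.2 ⟨hd, rfl⟩)⟩
  have h1 := (card_le_card hsub).trans (card_biUnion_le_card_mul _ _ _ hclass)
  rw [card_range] at h1
  have h2 : (E.image (· % q)).card ≤ 18 * b * Nat.gcd q s.natAbs := by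
    calc _ ≤ 3 * b * (2 * g) := h1
      _ ≤ 3 * b * (2 * (3 * Nat.gcd q s.natAbs)) := by gcongr
      _ = _ := by ring
  exact_mod_cast h2

/-! ### Close pairs of moduli and the steps they determine -/

/-- The numbers `d² m(d)`, with `d ∈ F` of size about `D`, are at most `x`, coprime to `b`, all
congruent modulo `q²`, and all within `b x / q²` of each other. -/
structure NearSquares (b q : ℕ) (x D : ℝ) (F : Finset ℕ) (m : ℕ → ℕ) : Prop where
  range : ∀ d ∈ F, D ≤ d ∧ (d : ℝ) ≤ 2 * D
  coprime : ∀ d ∈ F, Nat.Coprime (d ^ 2 * m d) b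
  le : ∀ d ∈ F, (d : ℝ) ^ 2 * m d ≤ x
  close : ∀ d ∈ F, ∀ d' ∈ F, ((d : ℝ) ^ 2 * m d - (d' : ℝ) ^ 2 * m d') * (q : ℝ) ^ 2 ≤ b * x
  modEq : ∀ d ∈ F, ∀ d' ∈ F, (q : ℤ) ^ 2 ∣ (d : ℤ) ^ 2 * m d - (d' : ℤ) ^ 2 * m d'

namespace NearSquares

variable {b j : ℕ} {x D : ℝ} {F : Finset ℕ} {m : ℕ → ℕ}

theorem coprime_base {q : ℕ} (h : NearSquares b q x D F m) {d : ℕ} (hd : d ∈ F) :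
    Nat.Coprime d b :=
  Nat.Coprime.coprime_dvd_left (Dvd.intro_left (d * m d) (by ring)) (h.coprime d hd)

theorem isCoprime (h : NearSquares b (b ^ j) x D F m) {d : ℕ} (hd : d ∈ F) :
    IsCoprime ((b ^ j : ℕ) : ℤ) (d : ℤ) :=
  Nat.isCoprime_iff_coprime.2 ((h.coprime_base hd).symm.pow_left j)

theorem abs_close {q : ℕ} (h : NearSquares b q x D F m) {d d' : ℕ} (hd : d ∈ F) (hd' : d' ∈ F) :
    |(d : ℝ) ^ 2 * m d - (d' : ℝ) ^ 2 * m d'| * (q : ℝ) ^ 2 ≤ b * x := by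
  have h1 := h.close d hd d' hd'
  have h2 := h.close d' hd' d hd
  rcases abs_choice ((d : ℝ) ^ 2 * m d - (d' : ℝ) ^ 2 * m d') with e | e <;> rw [e] <;> linarith

/-- Two close and congruent moduli `d < d'` determine a step `(t, s)`, which is nearly a tangent
direction of the curve `d² m = const`, both for the real and for the `b`-adic metric. -/
theorem exists_step (hb : 2 ≤ b) (h : NearSquares b (b ^ j) x D F m) (hD : 1 ≤ D)
    (hx : x ≤ D * ((b ^ j : ℕ) : ℝ) ^ 6) {d d' : ℕ} (hd : d ∈ F) (hd' : d' ∈ F) (hlt : d < d')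
    (hmod : d % b ^ j = d' % b ^ j) (hshort : ((d' : ℝ) - d) * (b ^ j : ℕ) ≤ D)
    (hbig : b * (b ^ j) ^ 2 < m d) :
    ∃ t : ℕ, ∃ s : ℤ, 1 ≤ t ∧ (d' : ℝ) - d = (b ^ j : ℕ) * t ∧ s ≠ 0 ∧
      |(s : ℝ)| ≤ 2 * x / (D ^ 2 * ((b ^ j : ℕ) : ℝ) ^ 2) + (2 * b + 9) * ((b ^ j : ℕ) : ℝ) ^ 3 / D ∧
      |(d : ℝ) * s + 2 * m d * t| ≤ (2 * b + 9) * ((b ^ j : ℕ) : ℝ) ^ 3 ∧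
      ((b ^ j : ℕ) : ℤ) ∣ (d : ℤ) * s + 2 * m d * t := by
  set q := b ^ j with hq
  have hq0 : 0 < q := by positivity
  have hqR : (0 : ℝ) < q := by exact_mod_cast hq0
  have hqZ : (q : ℤ) ≠ 0 := by exact_mod_cast hq0.ne'
  have hcop := h.isCoprime hd
  have hdd : (q : ℤ) ∣ (d' : ℤ) - d := Nat.modEq_iff_dvd.1 hmod
  have hnn := h.modEq d' hd' d hd
  obtain ⟨s, hs⟩ := dvd_cofactor_sub hcop hdd ((Dvd.intro_left _ (by ring)).trans hnn)
  have hdd2 : q ∣ d' - d := (Nat.modEq_iff_dvd' hlt.le).1 hmod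
  obtain ⟨t, ht⟩ := hdd2
  have ht1 : 1 ≤ t := by
    rcases Nat.eq_zero_or_pos t with rfl | h0
    · omega
    · exact h0
  have hd'eq : (d' : ℤ) = d + q * t := by
    have : d' = d + q * t := by omega
    exact_mod_cast this
  have hm'eq : (m d' : ℤ) = m d + q * s := by linarith
  have hd'R : (d' : ℝ) = d + q * t := by exact_mod_cast hd'eq
  have hm'R : (m d' : ℝ) = m d + q * s := by exact_mod_cast hm'eq
  have hD0 : 0 < D := by linarith
  obtain ⟨hdl, hdu⟩ := h.range d hd
  obtain ⟨hdl', hdu'⟩ := h.range d' hd'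
  have htpos : (0 : ℝ) < t := by exact_mod_cast ht1
  have hmD : (m d : ℝ) * D ^ 2 ≤ x := by
    refine le_trans ?_ (h.le d hd)
    rw [mul_comm]; gcongr
  have hclose := h.abs_close hd' hd
  have hshort' : (q : ℝ) * t * q ≤ D := by
    have : (d' : ℝ) - d = q * t := by rw [hd'R]; ring
    rwa [this] at hshort
  have hdvd : (q : ℤ) ∣ (d : ℤ) * s + 2 * m d * t := by
    refine dvd_linear_form hqZ hcop ?_
    rw [← hd'eq, ← hm'eq]
    exact hnn
  have hv : |(d : ℝ) * s + 2 * m d * t| ≤ (2 * b + 9) * (q : ℝ) ^ 3 := by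
    have h1 := abs_linear_form_le (D := D) (d := d) (h := q * t) (m := m d) (u := q * s) (q := q)
      (B := b) (x := x) hD0 hdl (by rw [← hd'R]; exact hdu') (by positivity) (Nat.cast_nonneg _)
      hmD hqR hshort' (by rw [← hd'R, ← hm'R]; exact hclose)
    have e : (d : ℝ) * (q * s) + 2 * m d * (q * t) = q * (d * s + 2 * m d * t) := by ring
    rw [e, abs_mul, abs_of_pos hqR] at h1
    -- With increments qt and qs one factor q comes out of the linear form; the bound x ≤ Dq⁶ then
    -- leaves q³.
    have h2 : (q : ℝ) ^ 3 * D * |(d : ℝ) * s + 2 * m d * t| ≤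
        q ^ 3 * D * ((2 * b + 9) * (q : ℝ) ^ 3) := by
      calc (q : ℝ) ^ 3 * D * |(d : ℝ) * s + 2 * m d * t|
          = q * |(d : ℝ) * s + 2 * m d * t| * (q ^ 2 * D) := by ring
        _ ≤ (2 * b + 9) * x := h1
        _ ≤ (2 * b + 9) * (D * q ^ 6) := by gcongr
        _ = _ := by ring
    exact le_of_mul_le_mul_left h2 (by positivity)
  refine ⟨t, s, ht1, by rw [hd'R]; ring, ?_, ?_, hv, hdvd⟩
  -- If s = 0, then q divides 2mt with m a unit modulo q, so 2t ≥ q. The gap between the squares is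
  -- then so wide that closeness forces m ≤ bq², against `hbig`.
  · rintro rfl
    have hmm : (m d' : ℤ) = m d := by rw [hm'eq]; ring
    have h1 : (q : ℤ) ∣ 2 * t := by
      have h2 : (q : ℤ) ∣ (m d : ℤ) * (2 * t) := by
        have : (d : ℤ) * 0 + 2 * m d * t = m d * (2 * t) := by ring
        rwa [this] at hdvd
      have h3 : IsCoprime (q : ℤ) (m d : ℤ) :=
        Nat.isCoprime_iff_coprime.2 ((Nat.Coprime.coprime_dvd_left
          (Dvd.intro_left _ rfl) (h.coprime d hd)).symm.pow_left j)
      exact h3.dvd_of_dvd_mul_left h2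
    have h2 : q ≤ 2 * t := Nat.le_of_dvd (by omega) (by exact_mod_cast h1)
    have h2R : (q : ℝ) ≤ 2 * t := by exact_mod_cast h2
    have hmmR : (m d' : ℝ) = m d := by exact_mod_cast hmm
    have h3 : (m d : ℝ) * (q ^ 4 * D) ≤ b * (D * q ^ 6) := by
      calc (m d : ℝ) * (q ^ 4 * D) = m d * (q * D) * q * q ^ 2 := by ring
        _ ≤ m d * (q * D) * (2 * t) * q ^ 2 := by gcongr
        _ = m d * ((q * t) * (2 * D)) * q ^ 2 := by ring
        _ ≤ m d * ((q * t) * (d' + d)) * q ^ 2 := by gcongr; linarith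
        _ = ((d' : ℝ) ^ 2 * m d' - (d : ℝ) ^ 2 * m d) * q ^ 2 := by rw [hmmR, hd'R]; ring
        _ ≤ b * x := h.close d' hd' d hd
        _ ≤ b * (D * q ^ 6) := by gcongr
    have h4 : (m d : ℝ) ≤ b * q ^ 2 := by
      refine le_of_mul_le_mul_right (?_ : (m d : ℝ) * (q ^ 4 * D) ≤ _) (by positivity : 0 < q ^ 4 * D)
      exact h3.trans_eq (by ring)
    have h5 : (b * q ^ 2 : ℝ) < m d := by exact_mod_cast hbig
    linarith
  · have h1 : |(d : ℝ) * s| ≤ |(d : ℝ) * s + 2 * m d * t| + 2 * m d * t := by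
      have := abs_sub ((d : ℝ) * s + 2 * m d * t) (2 * m d * t)
      rw [add_sub_cancel_right, abs_of_nonneg (by positivity : (0 : ℝ) ≤ 2 * m d * t)] at this
      exact this
    rw [abs_mul, abs_of_nonneg (Nat.cast_nonneg d)] at h1
    have h2 : (2 : ℝ) * m d * t ≤ 2 * x / (D * q ^ 2) := by
      rw [le_div_iff₀ (by positivity)]
      calc (2 : ℝ) * m d * t * (D * q ^ 2) = 2 * m d * D * (q * t * q) := by ring
        _ ≤ 2 * m d * D * D := by gcongr
        _ = 2 * (m d * D ^ 2) := by ring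
        _ ≤ _ := by linarith
    have h3 : D * |(s : ℝ)| ≤ 2 * x / (D * q ^ 2) + (2 * b + 9) * (q : ℝ) ^ 3 := by
      have : D * |(s : ℝ)| ≤ d * |(s : ℝ)| := by gcongr
      linarith
    refine le_of_mul_le_mul_left (h3.trans_eq ?_) hD0
    field_simp

/-- The moduli that share a step `(t, s)` lie in few residue classes modulo `q` and in few
intervals of length `D / q`. -/
theorem card_step_le (hb : 2 ≤ b) (h : NearSquares b (b ^ j) x D F m) (hD : 1 ≤ D)
    (hx : x ≤ D * ((b ^ j : ℕ) : ℝ) ^ 6) {t : ℕ} {s : ℤ} (hs : s ≠ 0)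
    (ht : (t : ℝ) * ((b ^ j : ℕ) : ℝ) ^ 2 ≤ D) (E : Finset ℕ) (hE : E ⊆ F)
    (hinj : Set.InjOn (fun d : ℕ => (d % b ^ j, ⌊(d : ℝ) * (b ^ j : ℕ) / D⌋₊)) E)
    (hv : ∀ d ∈ E, |(d : ℝ) * s + 2 * m d * t| ≤ (2 * b + 9) * ((b ^ j : ℕ) : ℝ) ^ 3)
    (hdvd : ∀ d ∈ E, ((b ^ j : ℕ) : ℤ) ∣ (d : ℤ) * s + 2 * m d * t) :
    (E.card : ℝ) ≤ 18 * b * Nat.gcd (b ^ j) s.natAbs *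
      ((6 * b + 24) * ((b ^ j : ℕ) : ℝ) ^ 4 / (D * s.natAbs) + 2) := by
  classical
  have hres := card_image_mod_le (j := j) hb (s := s) E
    (fun d hd => h.coprime_base (hE hd)) (fun d hd d' hd' => by
      -- Multiplying ds + 2mt by d² gives sd³ + 2t·d²m, whose second term is nearly independent of
      -- d. The same identity serves below over the reals.
      have e : s * ((d : ℤ) ^ 3 - (d' : ℤ) ^ 3) = (d : ℤ) ^ 2 * ((d : ℤ) * s + 2 * m d * t) -
          (d' : ℤ) ^ 2 * ((d' : ℤ) * s + 2 * m d' * t) -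
          ((d : ℤ) ^ 2 * m d - (d' : ℤ) ^ 2 * m d') * (2 * t) := by ring
      rw [e]
      exact dvd_sub (dvd_sub (Dvd.dvd.mul_left (hdvd d hd) _) (Dvd.dvd.mul_left (hdvd d' hd') _))
        (Dvd.dvd.mul_right ((Dvd.intro_left _ (by ring)).trans (h.modEq d (hE hd) d' (hE hd'))) _))
  set q := b ^ j with hq
  have hq0 : 0 < q := by positivity
  have hqR : (1 : ℝ) ≤ q := by exact_mod_cast hq0
  have hD0 : 0 < D := by linarith
  have hsR : (0 : ℝ) < |(s : ℝ)| := abs_pos.2 (by exact_mod_cast hs)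
  have hsabs : ((s.natAbs : ℕ) : ℝ) = |(s : ℝ)| := by
    rw [Nat.cast_natAbs, Int.cast_abs]
  have hdist : ∀ d ∈ E, ∀ d' ∈ E, |(s : ℝ)| * ((d : ℝ) - d') ≤ (6 * b + 24) * (q : ℝ) ^ 3 := by
    intro d hd d' hd'
    rcases le_or_gt (d : ℝ) d' with hle | hlt
    · have : |(s : ℝ)| * ((d : ℝ) - d') ≤ 0 :=
        mul_nonpos_of_nonneg_of_nonpos hsR.le (by linarith)
      exact this.trans (by positivity)
    obtain ⟨hl, hu⟩ := h.range d (hE hd)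
    obtain ⟨hl', hu'⟩ := h.range d' (hE hd')
    have hsq : ∀ d ∈ E, (d : ℝ) ^ 2 ≤ 4 * D ^ 2 := fun d hd => by
      have := (h.range d (hE hd)).2
      calc (d : ℝ) ^ 2 ≤ (2 * D) ^ 2 := by gcongr
        _ = _ := by ring
    have h1 : |(s : ℝ) * ((d : ℝ) ^ 3 - (d' : ℝ) ^ 3)| ≤
        (d : ℝ) ^ 2 * |(d : ℝ) * s + 2 * m d * t| + (d' : ℝ) ^ 2 * |(d' : ℝ) * s + 2 * m d' * t| +
          |(d : ℝ) ^ 2 * m d - (d' : ℝ) ^ 2 * m d'| * (2 * t) := by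
      have e : (s : ℝ) * ((d : ℝ) ^ 3 - (d' : ℝ) ^ 3) = (d : ℝ) ^ 2 * ((d : ℝ) * s + 2 * m d * t) -
          (d' : ℝ) ^ 2 * ((d' : ℝ) * s + 2 * m d' * t) -
          ((d : ℝ) ^ 2 * m d - (d' : ℝ) ^ 2 * m d') * (2 * t) := by ring
      rw [e]
      refine (abs_sub _ _).trans ((add_le_add_left (abs_sub _ _) _).trans_eq ?_)
      rw [abs_mul, abs_mul, abs_mul, abs_of_nonneg (sq_nonneg (d : ℝ)),
        abs_of_nonneg (sq_nonneg (d' : ℝ)), abs_of_nonneg (by positivity : (0 : ℝ) ≤ 2 * t)]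
    have h2 : |(d : ℝ) ^ 2 * m d - (d' : ℝ) ^ 2 * m d'| * (2 * t) ≤ 2 * b * (D ^ 2 * q ^ 2) := by
      refine le_of_mul_le_mul_right ?_ (by positivity : 0 < (q : ℝ) ^ 2 * (q : ℝ) ^ 2)
      calc |(d : ℝ) ^ 2 * m d - (d' : ℝ) ^ 2 * m d'| * (2 * t) * ((q : ℝ) ^ 2 * (q : ℝ) ^ 2)
          = 2 * (|(d : ℝ) ^ 2 * m d - (d' : ℝ) ^ 2 * m d'| * (q : ℝ) ^ 2) * (t * (q : ℝ) ^ 2) := by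
            ring
        _ ≤ 2 * (b * x) * D := by
            have := h.abs_close (hE hd) (hE hd')
            have : 0 ≤ x := le_trans (by positivity) (h.le d (hE hd))
            gcongr
        _ ≤ 2 * (b * (D * q ^ 6)) * D := by gcongr
        _ = _ := by ring
    have h2' : 2 * b * (D ^ 2 * (q : ℝ) ^ 2) ≤ 2 * b * (D ^ 2 * q ^ 3) := by
      gcongr
      norm_num
    have h3 : 3 * D ^ 2 * ((d : ℝ) - d') ≤ (d : ℝ) ^ 3 - (d' : ℝ) ^ 3 := by
      have e : (d : ℝ) ^ 3 - (d' : ℝ) ^ 3 = ((d : ℝ) ^ 2 + d * d' + (d' : ℝ) ^ 2) * (d - d') := by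
        ring
      rw [e]
      have : 3 * D ^ 2 ≤ (d : ℝ) ^ 2 + d * d' + (d' : ℝ) ^ 2 := by nlinarith
      exact mul_le_mul_of_nonneg_right this (by linarith)
    have h4 : 3 * D ^ 2 * (|(s : ℝ)| * ((d : ℝ) - d')) ≤
        3 * D ^ 2 * ((6 * b + 24) * (q : ℝ) ^ 3) := by
      calc 3 * D ^ 2 * (|(s : ℝ)| * ((d : ℝ) - d'))
          = |(s : ℝ)| * (3 * D ^ 2 * ((d : ℝ) - d')) := by ring
        _ ≤ |(s : ℝ)| * |(d : ℝ) ^ 3 - (d' : ℝ) ^ 3| := by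
            gcongr
            exact h3.trans (le_abs_self _)
        _ = |(s : ℝ) * ((d : ℝ) ^ 3 - (d' : ℝ) ^ 3)| := (abs_mul _ _).symm
        _ ≤ _ := h1
        _ ≤ 4 * D ^ 2 * ((2 * b + 9) * (q : ℝ) ^ 3) + 4 * D ^ 2 * ((2 * b + 9) * (q : ℝ) ^ 3) +
            2 * b * (D ^ 2 * q ^ 3) := by
            refine add_le_add (add_le_add ?_ ?_) (h2.trans h2')
            · exact mul_le_mul (hsq d hd) (hv d hd) (abs_nonneg _) (by positivity)
            · exact mul_le_mul (hsq d' hd') (hv d' hd') (abs_nonneg _) (by positivity)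
        _ = _ := by ring
    exact le_of_mul_le_mul_left h4 (by positivity)
  have hint : ((E.image fun d : ℕ => ⌊(d : ℝ) * q / D⌋₊).card : ℝ) ≤
      (6 * b + 24) * (q : ℝ) ^ 4 / (D * s.natAbs) + 2 := by
    have := card_le_of_separated (E.image fun d : ℕ => ⌊(d : ℝ) * q / D⌋₊) (fun n : ℕ => (n : ℝ))
      (δ := 1) (W := (6 * b + 24) * (q : ℝ) ^ 4 / (D * s.natAbs) + 1) one_pos (by positivity)
      (fun u _ v _ huv => by
        have h1 : (1 : ℤ) ≤ |(u : ℤ) - v| := Int.one_le_abs (sub_ne_zero.2 (by exact_mod_cast huv))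
        exact_mod_cast h1)
      (fun u hu v hv => by
        obtain ⟨d, hd, rfl⟩ := mem_image.1 hu
        obtain ⟨d', hd', rfl⟩ := mem_image.1 hv
        have h1 := Nat.floor_le (by positivity : 0 ≤ (d : ℝ) * q / D)
        have h2 := Nat.lt_floor_add_one ((d' : ℝ) * q / D)
        have h3 : (d : ℝ) * q / D - (d' : ℝ) * q / D ≤
            (6 * b + 24) * (q : ℝ) ^ 4 / (D * s.natAbs) := by
          rw [hsabs, le_div_iff₀ (by positivity)]
          have e : ((d : ℝ) * q / D - (d' : ℝ) * q / D) * (D * |(s : ℝ)|) =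
              q * (|(s : ℝ)| * ((d : ℝ) - d')) := by field_simp
          rw [e]
          calc (q : ℝ) * (|(s : ℝ)| * ((d : ℝ) - d')) ≤ q * ((6 * b + 24) * (q : ℝ) ^ 3) :=
                mul_le_mul_of_nonneg_left (hdist d hd d' hd') (Nat.cast_nonneg q)
            _ = _ := by ring
        linarith)
    linarith
  -- By `hinj` each cell contains at most one d of `E`, so residues times intervals bounds the
  -- count.
  have hprod : E.card ≤ (E.image (· % q)).card * (E.image fun d : ℕ => ⌊(d : ℝ) * q / D⌋₊).card := by
    rw [← card_product]
    refine card_le_card_of_injOn _ (fun d hd => ?_) hinj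
    simp only [coe_product, Set.mem_prod, coe_image]
    exact ⟨⟨d, hd, rfl⟩, ⟨d, hd, rfl⟩⟩
  calc (E.card : ℝ) ≤ (E.image (· % q)).card * (E.image fun d : ℕ => ⌊(d : ℝ) * q / D⌋₊).card := by
        exact_mod_cast hprod
    _ ≤ _ := mul_le_mul hres hint (Nat.cast_nonneg _) (by positivity)

end NearSquares

/-! ### Summation over steps: large cofactors -/

namespace NearSquares

variable {b j : ℕ} {x D ℓ : ℝ} {F : Finset ℕ} {m : ℕ → ℕ}

theorem sq_le {q : ℕ} (h : NearSquares b q x D F m) (hD : 1 ≤ D) {d : ℕ} (hd : d ∈ F)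
    (hm : 0 < m d) : D ^ 2 ≤ x := by
  have h1 := (h.range d hd).1
  have h2 : (1 : ℝ) ≤ m d := by exact_mod_cast hm
  calc D ^ 2 = D ^ 2 * 1 := (mul_one _).symm
    _ ≤ (d : ℝ) ^ 2 * m d := by gcongr
    _ ≤ x := h.le d hd

/-- Each cell costs 1, for a total of O(q²), plus T/t when it holds at least two moduli and has step
(t, s). Grouping these cells by step and applying `card_step_le` separates the second cost into a
sum over t ≤ T and a gcd-weighted sum over |s| ≤ R. -/
theorem card_le_of_large (hb : 2 ≤ b) (h : NearSquares b (b ^ j) x D F m) (hD : 1 ≤ D)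
    (hx : x ≤ D * ((b ^ j : ℕ) : ℝ) ^ 6) (hbig : ∀ d ∈ F, b * (b ^ j) ^ 2 < m d) (hℓ1 : 1 ≤ ℓ)
    (hℓ : ∀ n : ℕ, (n : ℝ) ≤ (2 * b + 11) * x * ((b ^ j : ℕ) : ℝ) ^ 3 →
      ∑ i ∈ Icc 1 n, (i : ℝ)⁻¹ ≤ ℓ) :
    (F.card : ℝ) ≤ (3 + 36 * b * (10 * b + 46)) *
      (((b ^ j : ℕ) : ℝ) ^ 2 * (b ^ j).divisors.card * ℓ ^ 2) := by
  classical
  rcases F.eq_empty_or_nonempty with rfl | ⟨d₀, hd₀⟩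
  · simp only [card_empty, Nat.cast_zero]; positivity
  have hDx : D ^ 2 ≤ x := h.sq_le hD hd₀ (by have := hbig d₀ hd₀; omega)
  have hx1 : 1 ≤ x := by nlinarith
  have hD0 : 0 < D := by linarith
  set q := b ^ j with hq
  have hq0 : 0 < q := by positivity
  have hq1 : (1 : ℝ) ≤ q := by exact_mod_cast hq0
  have hqR : (0 : ℝ) < q := by linarith
  set τ : ℝ := (q.divisors.card : ℝ) with hτ
  have hτ1 : 1 ≤ τ := by
    have : 0 < q.divisors.card := card_pos.2 ⟨q, Nat.mem_divisors_self q hq0.ne'⟩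
    exact Nat.one_le_cast.2 this
  set T : ℝ := D / (q : ℝ) ^ 2 with hT
  set R : ℝ := 2 * x / (D ^ 2 * (q : ℝ) ^ 2) + (2 * b + 9) * (q : ℝ) ^ 3 / D with hR
  have hT0 : 0 ≤ T := by positivity
  have hR0 : 0 ≤ R := by positivity
  set cls : ℕ → ℕ × ℕ := fun d => (d % q, ⌊(d : ℝ) * q / D⌋₊) with hcls
  set Cls := F.image cls with hCls
  set fib : ℕ × ℕ → Finset ℕ := fun c => F.filter (cls · = c) with hfib
  have hCard : (Cls.card : ℝ) ≤ 3 * (q : ℝ) ^ 2 := by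
    have h1 : Cls ⊆ Finset.range q ×ˢ Finset.range (2 * q + 1) := by
      intro c hc
      obtain ⟨d, hd, rfl⟩ := mem_image.1 hc
      rw [mem_product, mem_range, mem_range]
      refine ⟨Nat.mod_lt _ hq0, Nat.lt_succ_of_le (Nat.floor_le_of_le ?_)⟩
      rw [div_le_iff₀ hD0]
      push_cast
      nlinarith [(h.range d hd).2]
    have h2 := card_le_card h1
    rw [card_product, card_range, card_range] at h2
    have h3 : (Cls.card : ℝ) ≤ q * (2 * q + 1) := by exact_mod_cast h2
    nlinarith
  set Cl2 := Cls.filter (fun c => 2 ≤ (fib c).card) with hCl2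
  -- One close pair, hence one modulus and one step, is selected in every cell with at least two
  -- moduli.
  have hdata : ∀ c ∈ Cl2, ∃ d t : ℕ, ∃ s : ℤ, d ∈ F ∧ cls d = c ∧ 1 ≤ t ∧
      (t : ℝ) * (q : ℝ) ^ 2 ≤ D ∧ ((fib c).card : ℝ) ≤ 1 + T / t ∧ s ≠ 0 ∧ |(s : ℝ)| ≤ R ∧
      |(d : ℝ) * s + 2 * m d * t| ≤ (2 * b + 9) * (q : ℝ) ^ 3 ∧
      (q : ℤ) ∣ (d : ℤ) * s + 2 * m d * t := by
    intro c hc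
    obtain ⟨-, hc2⟩ := mem_filter.1 hc
    have hwid : ∀ u ∈ fib c, ∀ v ∈ fib c, (u : ℝ) - v ≤ D / q := by
      intro u hu v hv
      obtain ⟨-, hu⟩ := mem_filter.1 hu
      obtain ⟨-, hv⟩ := mem_filter.1 hv
      have e : ⌊(u : ℝ) * q / D⌋₊ = ⌊(v : ℝ) * q / D⌋₊ := (Prod.ext_iff.1 (hu.trans hv.symm)).2
      have h1 := Nat.lt_floor_add_one ((u : ℝ) * q / D)
      have h2 := Nat.floor_le (by positivity : 0 ≤ (v : ℝ) * q / D)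
      rw [e] at h1
      have h3 : (u : ℝ) * q / D - (v : ℝ) * q / D ≤ 1 := by linarith
      rw [← sub_div, div_le_one hD0] at h3
      rw [le_div_iff₀ hqR]
      linarith
    obtain ⟨d, hd, d', hd', hlt, hdd⟩ := exists_close_pair (fib c) hc2 hwid
    obtain ⟨hdF, hdc⟩ := mem_filter.1 hd
    obtain ⟨hdF', hdc'⟩ := mem_filter.1 hd'
    have hmod : d % q = d' % q := (Prod.ext_iff.1 (hdc.trans hdc'.symm)).1
    have hshort : ((d' : ℝ) - d) * q ≤ D := by
      have := hwid d' hd' d hd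
      rwa [le_div_iff₀ hqR] at this
    obtain ⟨t, s, ht1, ht, hs0, hsR, hv, hdvd⟩ :=
      h.exists_step hb hD hx hdF hdF' hlt hmod hshort (hbig d hdF)
    have htpos : (0 : ℝ) < t := by exact_mod_cast ht1
    refine ⟨d, t, s, hdF, hdc, ht1, ?_, ?_, hs0, hsR, hv, hdvd⟩
    · rw [ht] at hshort
      linarith
    · rw [ht, le_div_iff₀ hqR] at hdd
      have : ((fib c).card : ℝ) - 1 ≤ T / t := by
        rw [hT, div_div, le_div_iff₀ (by positivity)]
        linarith
      linarith
  choose! dd tt ss hdF hdc ht1 htD hfc hs0 hsR hv hdvd using hdata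
  -- The step is encoded as t, |s| and the sign of s, so that the sums run over positive integers;
  -- the sign costs the factor 2 below.
  set K : Finset (ℕ × ℕ × Bool) := Icc 1 ⌊T⌋₊ ×ˢ Icc 1 ⌊R⌋₊ ×ˢ univ with hK
  set key : ℕ × ℕ → ℕ × ℕ × Bool := fun c => (tt c, (ss c).natAbs, decide (0 < ss c)) with hkey
  have hmaps : ∀ c ∈ Cl2, key c ∈ K := by
    intro c hc
    simp only [hK, hkey, mem_product, mem_Icc, mem_univ, and_true]
    refine ⟨⟨ht1 c hc, Nat.le_floor ?_⟩, Int.natAbs_pos.2 (hs0 c hc), Nat.le_floor ?_⟩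
    · rw [hT, le_div_iff₀ (by positivity)]; exact htD c hc
    · rw [Nat.cast_natAbs, Int.cast_abs]; exact hsR c hc
  have hstep : ∀ κ ∈ K, ((Cl2.filter (key · = κ)).card : ℝ) ≤
      18 * b * Nat.gcd q κ.2.1 * ((6 * b + 24) * (q : ℝ) ^ 4 / (D * κ.2.1) + 2) := by
    intro κ _
    rcases (Cl2.filter (key · = κ)).eq_empty_or_nonempty with he | ⟨c₀, hc₀'⟩
    · rw [he, card_empty, Nat.cast_zero]; positivity
    obtain ⟨hc₀, rfl⟩ := mem_filter.1 hc₀'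
    have hsame : ∀ c ∈ Cl2.filter (key · = key c₀), tt c = tt c₀ ∧ ss c = ss c₀ := by
      intro c hc
      obtain ⟨hc, hck⟩ := mem_filter.1 hc
      simp only [hkey, Prod.mk.injEq, decide_eq_decide] at hck
      refine ⟨hck.1, ?_⟩
      have := hs0 c hc
      have := hs0 c₀ hc₀
      omega
    have hinj : Set.InjOn dd (Cl2.filter (key · = key c₀)) := by
      intro c hc c' hc' e
      rw [← hdc c (mem_filter.1 hc).1, ← hdc c' (mem_filter.1 hc').1, e]
    rw [← card_image_of_injOn hinj]
    refine h.card_step_le hb hD hx (hs0 c₀ hc₀) (htD c₀ hc₀) _ ?_ ?_ ?_ ?_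
    · intro d hd
      obtain ⟨c, hc, rfl⟩ := mem_image.1 hd
      exact hdF c (mem_filter.1 hc).1
    · intro d hd d' hd' e
      obtain ⟨c, hc, rfl⟩ := mem_image.1 (mem_coe.1 hd)
      obtain ⟨c', hc', rfl⟩ := mem_image.1 (mem_coe.1 hd')
      have e1 := hdc c (mem_filter.1 hc).1
      have e2 := hdc c' (mem_filter.1 hc').1
      have e3 : cls (dd c) = cls (dd c') := e
      rw [e1, e2] at e3
      rw [e3]
    · intro d hd
      obtain ⟨c, hc, rfl⟩ := mem_image.1 hd
      rw [← (hsame c hc).1, ← (hsame c hc).2]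
      exact hv c (mem_filter.1 hc).1
    · intro d hd
      obtain ⟨c, hc, rfl⟩ := mem_image.1 hd
      rw [← (hsame c hc).1, ← (hsame c hc).2]
      exact hdvd c (mem_filter.1 hc).1
  have hsumt : ∑ t ∈ Icc 1 ⌊T⌋₊, T / (t : ℝ) ≤ T * ℓ := by
    simp_rw [div_eq_mul_inv]
    rw [← mul_sum]
    refine mul_le_mul_of_nonneg_left (hℓ _ ?_) hT0
    have h1 : T ≤ D := div_le_self hD0.le (one_le_pow₀ hq1)
    have h2 : (1 : ℝ) ≤ (q : ℝ) ^ 3 := one_le_pow₀ hq1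
    calc (⌊T⌋₊ : ℝ) ≤ T := Nat.floor_le hT0
      _ ≤ x := by nlinarith
      _ = 1 * x * 1 := by ring
      _ ≤ (2 * b + 11) * x * (q : ℝ) ^ 3 := by
        gcongr
        have : (0 : ℝ) ≤ b := Nat.cast_nonneg b
        linarith
  have hsums : ∑ s ∈ Icc 1 ⌊R⌋₊,
      18 * (b : ℝ) * Nat.gcd q s * ((6 * b + 24) * (q : ℝ) ^ 4 / (D * s) + 2) ≤
      18 * b * τ * ((6 * b + 24) * (q : ℝ) ^ 4 / D * ℓ + 2 * R) := by
    have hRℓ : ∑ i ∈ Icc 1 ⌊R⌋₊, (i : ℝ)⁻¹ ≤ ℓ := by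
      refine hℓ _ ((Nat.floor_le hR0).trans ?_)
      have h1 : 2 * x / (D ^ 2 * (q : ℝ) ^ 2) ≤ 2 * x * (q : ℝ) ^ 3 := by
        have a : 2 * x / (D ^ 2 * (q : ℝ) ^ 2) ≤ 2 * x :=
          div_le_self (by positivity) (one_le_mul_of_one_le_of_one_le (one_le_pow₀ hD)
            (one_le_pow₀ hq1))
        have a2 : 2 * x * 1 ≤ 2 * x * (q : ℝ) ^ 3 := by
          gcongr
          exact one_le_pow₀ hq1
        linarith
      have h2 : (2 * b + 9) * (q : ℝ) ^ 3 / D ≤ (2 * b + 9) * x * (q : ℝ) ^ 3 := by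
        have a : (2 * b + 9) * (q : ℝ) ^ 3 / D ≤ (2 * b + 9) * (q : ℝ) ^ 3 :=
          div_le_self (by positivity) hD
        have a2 : (2 * b + 9) * (1 : ℝ) * (q : ℝ) ^ 3 ≤ (2 * b + 9) * x * (q : ℝ) ^ 3 := by
          gcongr
        linarith
      rw [hR]
      linarith
    calc ∑ s ∈ Icc 1 ⌊R⌋₊, 18 * (b : ℝ) * Nat.gcd q s * ((6 * b + 24) * (q : ℝ) ^ 4 / (D * s) + 2)
        = 18 * b * ((6 * b + 24) * (q : ℝ) ^ 4 / D *
            ∑ s ∈ Icc 1 ⌊R⌋₊, (Nat.gcd q s : ℝ) * (s : ℝ)⁻¹ +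
            2 * ∑ s ∈ Icc 1 ⌊R⌋₊, (Nat.gcd q s : ℝ)) := by
          rw [mul_sum, mul_sum, ← sum_add_distrib, mul_sum]
          refine sum_congr rfl fun s hs => ?_
          have : (0 : ℝ) < s := by exact_mod_cast (mem_Icc.1 hs).1
          field_simp
      _ ≤ 18 * b * ((6 * b + 24) * (q : ℝ) ^ 4 / D * (τ * ℓ) + 2 * (τ * R)) := by
          refine mul_le_mul_of_nonneg_left (add_le_add (mul_le_mul_of_nonneg_left ?_ ?_)
            (mul_le_mul_of_nonneg_left ?_ zero_le_two)) (by positivity)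
          · exact (sum_gcd_div_le q _ hq0).trans (mul_le_mul_of_nonneg_left hRℓ (by positivity))
          · positivity
          · exact (sum_gcd_le q _ hq0).trans
              (mul_le_mul_of_nonneg_left (Nat.floor_le hR0) (by positivity))
      _ = _ := by ring
  have hmain : ∑ c ∈ Cl2, T / (tt c : ℝ) ≤
      36 * b * (10 * b + 46) * ((q : ℝ) ^ 2 * τ * ℓ ^ 2) := by
    calc ∑ c ∈ Cl2, T / (tt c : ℝ)
        = ∑ κ ∈ K, ∑ c ∈ Cl2 with key c = κ, T / (tt c : ℝ) :=
          (sum_fiberwise_of_maps_to hmaps _).symm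
      _ = ∑ κ ∈ K, ((Cl2.filter (key · = κ)).card : ℝ) * (T / (κ.1 : ℝ)) := by
          refine sum_congr rfl fun κ _ => ?_
          rw [← nsmul_eq_mul]
          refine sum_eq_card_nsmul fun c hc => ?_
          rw [← (mem_filter.1 hc).2]
      _ ≤ ∑ κ ∈ K, 18 * b * Nat.gcd q κ.2.1 *
            ((6 * b + 24) * (q : ℝ) ^ 4 / (D * κ.2.1) + 2) * (T / (κ.1 : ℝ)) :=
          sum_le_sum fun κ hκ => mul_le_mul_of_nonneg_right (hstep κ hκ) (by positivity)
      _ = 2 * ((∑ s ∈ Icc 1 ⌊R⌋₊, 18 * (b : ℝ) * Nat.gcd q s *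
            ((6 * b + 24) * (q : ℝ) ^ 4 / (D * s) + 2)) * ∑ t ∈ Icc 1 ⌊T⌋₊, T / (t : ℝ)) := by
          rw [hK, sum_product, mul_sum, mul_sum]
          refine sum_congr rfl fun t _ => ?_
          rw [sum_product, sum_mul, mul_sum]
          refine sum_congr rfl fun s _ => ?_
          simp only [sum_const, card_univ, Fintype.card_bool, nsmul_eq_mul, Nat.cast_ofNat]
      _ ≤ 2 * ((18 * b * τ * ((6 * b + 24) * (q : ℝ) ^ 4 / D * ℓ + 2 * R)) * (T * ℓ)) := by
          refine mul_le_mul_of_nonneg_left (mul_le_mul hsums hsumt ?_ ?_) zero_le_two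
          · exact sum_nonneg fun _ _ => by positivity
          · positivity
      _ = 36 * b * τ * ℓ * ((6 * b + 24) * ((q : ℝ) ^ 4 / D * T) * ℓ + 2 * (T * R)) := by ring
      _ ≤ 36 * b * τ * ℓ * ((6 * b + 24) * (q : ℝ) ^ 2 * ℓ + 2 * ((2 * b + 11) * (q : ℝ) ^ 2 * ℓ)) := by
          -- The choice of q is used here: x ≤ Dq⁶ makes T·R at most (2b + 11)q², the same order as
          -- the number of cells.
          have e1 : (q : ℝ) ^ 4 / D * T = (q : ℝ) ^ 2 := by rw [hT]; field_simp
          have e2 : T * R = 2 * (x / (D * (q : ℝ) ^ 4)) + (2 * b + 9) * q := by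
            rw [hT, hR]; field_simp
          have e3 : x / (D * (q : ℝ) ^ 4) ≤ (q : ℝ) ^ 2 := by
            rw [div_le_iff₀ (by positivity)]
            exact hx.trans_eq (by ring)
          have e4 : (2 * b + 9) * (q : ℝ) ≤ (2 * b + 9) * (q : ℝ) ^ 2 := by
            gcongr
            nlinarith
          have e5 : (2 * b + 11) * (q : ℝ) ^ 2 * 1 ≤ (2 * b + 11) * (q : ℝ) ^ 2 * ℓ := by gcongr
          rw [e1, e2]
          gcongr
          linarith
      _ = _ := by ring
  have hsplit : (F.card : ℝ) = ∑ c ∈ Cls, ((fib c).card : ℝ) := by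
    exact_mod_cast card_eq_sum_card_image cls F
  have h1 : (1 : ℝ) ≤ τ * ℓ ^ 2 := one_le_mul_of_one_le_of_one_le hτ1 (one_le_pow₀ hℓ1)
  calc (F.card : ℝ) = ∑ c ∈ Cls, ((fib c).card : ℝ) := hsplit
    _ ≤ ∑ c ∈ Cls, (1 + if 2 ≤ (fib c).card then T / (tt c : ℝ) else 0) := by
        refine sum_le_sum fun c hc => ?_
        split_ifs with hc2
        · exact hfc c (mem_filter.2 ⟨hc, hc2⟩)
        · have : (fib c).card ≤ 1 := by omega
          rw [add_zero]
          exact_mod_cast this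
    _ = Cls.card + ∑ c ∈ Cl2, T / (tt c : ℝ) := by
        rw [sum_add_distrib, ← sum_filter, sum_const, nsmul_eq_mul, mul_one]
    _ ≤ 3 * (q : ℝ) ^ 2 + 36 * b * (10 * b + 46) * ((q : ℝ) ^ 2 * τ * ℓ ^ 2) :=
        add_le_add hCard hmain
    _ ≤ 3 * ((q : ℝ) ^ 2 * (τ * ℓ ^ 2)) + 36 * b * (10 * b + 46) * ((q : ℝ) ^ 2 * τ * ℓ ^ 2) := by
        gcongr
        exact le_mul_of_one_le_right (by positivity) h1
    _ = _ := by ring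

end NearSquares

/-! ### Small cofactors, and the combined count -/

namespace NearSquares

variable {b j : ℕ} {x D ℓ : ℝ} {F : Finset ℕ} {m : ℕ → ℕ}

/-- With the cofactor fixed at μ, q² divides μ(d − d')(d + d'). For d ≡ d' modulo 2b, d + d' is
twice a unit modulo q, so such moduli are at least q²/2 apart, while closeness confines them to a
length bq⁴/(2μ). -/
theorem card_le_of_eq_cofactor (hb : 2 ≤ b) (h : NearSquares b (b ^ j) x D F m) (hD : 1 ≤ D)
    (hx : x ≤ D * ((b ^ j : ℕ) : ℝ) ^ 6) {μ : ℕ} (hμ : 0 < μ) (hF : ∀ d ∈ F, m d = μ) :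
    (F.card : ℝ) ≤ 2 * b * (b * ((b ^ j : ℕ) : ℝ) ^ 2 * (μ : ℝ)⁻¹ + 1) := by
  classical
  set q := b ^ j with hq
  have hq0 : 0 < q := by positivity
  have hqR : (0 : ℝ) < q := by exact_mod_cast hq0
  have hμR : (0 : ℝ) < μ := by exact_mod_cast hμ
  have hD0 : 0 < D := by linarith
  have hclass : ∀ w ∈ Finset.range (2 * b), ((F.filter (· % (2 * b) = w)).card : ℝ) ≤
      b * (q : ℝ) ^ 2 * (μ : ℝ)⁻¹ + 1 := by
    intro w _
    have := card_le_of_separated (F.filter (· % (2 * b) = w)) (fun n : ℕ => (n : ℝ))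
      (δ := (q : ℝ) ^ 2 / 2) (W := b * (q : ℝ) ^ 4 / (2 * μ)) (by positivity) (by positivity)
      (fun d hd d' hd' hne => by
        rw [mem_filter] at hd hd'
        obtain ⟨k, hk⟩ :=
          (Nat.modEq_iff_dvd.1 (hd'.2.trans hd.2.symm : d' ≡ d [MOD 2 * b]))
        push_cast at hk
        have h1 := h.modEq d hd.1 d' hd'.1
        rw [hF d hd.1, hF d' hd'.1] at h1
        have e : (d : ℤ) ^ 2 * μ - (d' : ℤ) ^ 2 * μ =
            (2 * ((d : ℤ) - d')) * (μ * ((d' : ℤ) + b * k)) := by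
          have : (d : ℤ) = d' + 2 * b * k := by linarith
          rw [this]; ring
        rw [e] at h1
        have hcop : IsCoprime ((q : ℤ) ^ 2) (μ * ((d' : ℤ) + b * k)) := by
          apply IsCoprime.pow_left
          rw [hq]; push_cast
          apply IsCoprime.pow_left
          refine IsCoprime.mul_right ?_ ?_
          · refine Nat.isCoprime_iff_coprime.2 (Nat.Coprime.symm ?_)
            rw [← hF d hd.1]
            exact Nat.Coprime.coprime_dvd_left (Dvd.intro_left _ rfl) (h.coprime d hd.1)
          · rw [IsCoprime.add_mul_left_right_iff]
            exact Nat.isCoprime_iff_coprime.2 (h.coprime_base hd'.1).symm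
        have h2 : (q : ℤ) ^ 2 ≤ |2 * ((d : ℤ) - d')| :=
          Int.le_of_dvd (abs_pos.2 (mul_ne_zero two_ne_zero (sub_ne_zero.2 (by exact_mod_cast hne))))
            ((dvd_abs _ _).2 (hcop.dvd_of_dvd_mul_right h1))
        rw [abs_mul, abs_two] at h2
        have h3 : (q : ℝ) ^ 2 ≤ 2 * |(d : ℝ) - d'| := by exact_mod_cast h2
        linarith)
      (fun d hd d' hd' => by
        rw [mem_filter] at hd hd'
        have h1 := h.close d hd.1 d' hd'.1
        rw [hF d hd.1, hF d' hd'.1] at h1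
        rcases le_or_gt (d : ℝ) d' with hle | hlt
        · exact (sub_nonpos.2 hle).trans (by positivity)
        rw [le_div_iff₀ (by positivity)]
        refine le_of_mul_le_mul_right ?_ (by positivity : 0 < D * (q : ℝ) ^ 2)
        have h2 := (h.range d hd.1).1
        have h3 := (h.range d' hd'.1).1
        calc ((d : ℝ) - d') * (2 * μ) * (D * (q : ℝ) ^ 2)
            = ((d : ℝ) - d') * (2 * D) * (μ * (q : ℝ) ^ 2) := by ring
          _ ≤ ((d : ℝ) - d') * (d + d') * (μ * (q : ℝ) ^ 2) := by
              refine mul_le_mul_of_nonneg_right (mul_le_mul_of_nonneg_left (by linarith)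
                (by linarith)) (by positivity)
          _ = ((d : ℝ) ^ 2 * μ - (d' : ℝ) ^ 2 * μ) * (q : ℝ) ^ 2 := by ring
          _ ≤ b * x := h1
          _ ≤ b * (D * (q : ℝ) ^ 6) := by gcongr
          _ = _ := by ring)
    refine this.trans_eq ?_
    field_simp
  have h1 : F.card = ∑ w ∈ Finset.range (2 * b), (F.filter (· % (2 * b) = w)).card :=
    card_eq_sum_card_fiberwise fun d _ =>
      mem_coe.2 (mem_range.2 (Nat.mod_lt _ (by omega : 0 < 2 * b)))
  calc (F.card : ℝ) = ∑ w ∈ Finset.range (2 * b), ((F.filter (· % (2 * b) = w)).card : ℝ) := by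
        exact_mod_cast h1
    _ ≤ ∑ w ∈ Finset.range (2 * b), (b * (q : ℝ) ^ 2 * (μ : ℝ)⁻¹ + 1) := sum_le_sum hclass
    _ = _ := by rw [sum_const, card_range, nsmul_eq_mul]; push_cast; ring

theorem mono {q : ℕ} (h : NearSquares b q x D F m) {G : Finset ℕ} (hG : G ⊆ F) :
    NearSquares b q x D G m where
  range d hd := h.range d (hG hd)
  coprime d hd := h.coprime d (hG hd)
  le d hd := h.le d (hG hd)
  close d hd d' hd' := h.close d (hG hd) d' (hG hd')
  modEq d hd d' hd' := h.modEq d (hG hd) d' (hG hd')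

/-- Summing the fixed-cofactor bound over μ ≤ bq² produces a harmonic sum from q²/μ and a second
contribution of order q² from the constant terms. -/
theorem card_le_of_small (hb : 2 ≤ b) (h : NearSquares b (b ^ j) x D F m) (hD : 1 ≤ D)
    (hx : x ≤ D * ((b ^ j : ℕ) : ℝ) ^ 6) (hpos : ∀ d ∈ F, 0 < m d)
    (hsmall : ∀ d ∈ F, m d ≤ b * (b ^ j) ^ 2) (hℓ1 : 1 ≤ ℓ)
    (hℓ : ∀ n : ℕ, (n : ℝ) ≤ (2 * b + 11) * x * ((b ^ j : ℕ) : ℝ) ^ 3 →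
      ∑ i ∈ Icc 1 n, (i : ℝ)⁻¹ ≤ ℓ) :
    (F.card : ℝ) ≤ 4 * b ^ 2 * (((b ^ j : ℕ) : ℝ) ^ 2 * ℓ) := by
  classical
  rcases F.eq_empty_or_nonempty with rfl | ⟨d₀, hd₀⟩
  · simp only [card_empty, Nat.cast_zero]; positivity
  have hx1 : 1 ≤ x := (one_le_pow₀ hD).trans (h.sq_le hD hd₀ (hpos d₀ hd₀))
  set q := b ^ j with hq
  have hq0 : 0 < q := by positivity
  have hq1 : (1 : ℝ) ≤ q := by exact_mod_cast hq0
  have h1 : F.card = ∑ μ ∈ Icc 1 (b * q ^ 2), (F.filter (m · = μ)).card :=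
    card_eq_sum_card_fiberwise fun d hd => mem_coe.2 (mem_Icc.2 ⟨hpos d hd, hsmall d hd⟩)
  have h2 : ∑ i ∈ Icc 1 (b * q ^ 2), (i : ℝ)⁻¹ ≤ ℓ := by
    refine hℓ _ ?_
    push_cast
    calc (b : ℝ) * (q : ℝ) ^ 2 = b * 1 * (q : ℝ) ^ 2 := by ring
      _ ≤ (2 * b + 11) * x * (q : ℝ) ^ 3 := by
        gcongr
        · have : (0 : ℝ) ≤ b := Nat.cast_nonneg b
          linarith
        · norm_num
  calc (F.card : ℝ) = ∑ μ ∈ Icc 1 (b * q ^ 2), ((F.filter (m · = μ)).card : ℝ) := by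
        exact_mod_cast h1
    _ ≤ ∑ μ ∈ Icc 1 (b * q ^ 2), 2 * b * (b * (q : ℝ) ^ 2 * (μ : ℝ)⁻¹ + 1) := by
        refine sum_le_sum fun μ hμ => ?_
        exact (h.mono (filter_subset _ _)).card_le_of_eq_cofactor hb hD hx (mem_Icc.1 hμ).1
          fun d hd => (mem_filter.1 hd).2
    _ = 2 * b * (b * (q : ℝ) ^ 2 * ∑ μ ∈ Icc 1 (b * q ^ 2), (μ : ℝ)⁻¹ + b * (q : ℝ) ^ 2) := by
        rw [← mul_sum, sum_add_distrib, ← mul_sum, sum_const, Nat.card_Icc, nsmul_eq_mul]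
        push_cast
        simp
    _ ≤ 2 * b * (b * (q : ℝ) ^ 2 * ℓ + b * (q : ℝ) ^ 2 * ℓ) := by
        exact mul_le_mul_of_nonneg_left (add_le_add (mul_le_mul_of_nonneg_left h2 (by positivity))
          (le_mul_of_one_le_right (by positivity) hℓ1)) (by positivity)
    _ = _ := by ring

theorem card_le (hb : 2 ≤ b) (h : NearSquares b (b ^ j) x D F m) (hD : 1 ≤ D)
    (hx : x ≤ D * ((b ^ j : ℕ) : ℝ) ^ 6) (hpos : ∀ d ∈ F, 0 < m d) (hℓ1 : 1 ≤ ℓ)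
    (hℓ : ∀ n : ℕ, (n : ℝ) ≤ (2 * b + 11) * x * ((b ^ j : ℕ) : ℝ) ^ 3 →
      ∑ i ∈ Icc 1 n, (i : ℝ)⁻¹ ≤ ℓ) :
    (F.card : ℝ) ≤ (3 + 36 * b * (10 * b + 46) + 4 * b ^ 2) *
      (((b ^ j : ℕ) : ℝ) ^ 2 * (b ^ j).divisors.card * ℓ ^ 2) := by
  classical
  have h1 := (h.mono (filter_subset (fun d => m d ≤ b * (b ^ j) ^ 2) F)).card_le_of_small hb hD hx
    (fun d hd => hpos d (mem_filter.1 hd).1) (fun d hd => (mem_filter.1 hd).2) hℓ1 hℓ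
  have h2 := (h.mono (filter_subset (fun d => ¬ m d ≤ b * (b ^ j) ^ 2) F)).card_le_of_large hb hD hx
    (fun d hd => not_le.1 (mem_filter.1 hd).2) hℓ1 hℓ
  have h3 := card_filter_add_card_filter_not (s := F) (fun d => m d ≤ b * (b ^ j) ^ 2)
  have h4 : (F.card : ℝ) = ((F.filter (fun d => m d ≤ b * (b ^ j) ^ 2)).card : ℝ) +
      ((F.filter (fun d => ¬ m d ≤ b * (b ^ j) ^ 2)).card : ℝ) := by exact_mod_cast h3.symm
  have hτ1 : (1 : ℝ) ≤ ((b ^ j).divisors.card : ℝ) := by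
    have hq0 : b ^ j ≠ 0 := by positivity
    have : 0 < (b ^ j).divisors.card := card_pos.2 ⟨_, Nat.mem_divisors_self _ hq0⟩
    exact Nat.one_le_cast.2 this
  have h5 : ℓ ≤ (b ^ j).divisors.card * ℓ ^ 2 := by nlinarith
  have h6 : 4 * (b : ℝ) ^ 2 * (((b ^ j : ℕ) : ℝ) ^ 2 * ℓ) ≤
      4 * b ^ 2 * (((b ^ j : ℕ) : ℝ) ^ 2 * ((b ^ j).divisors.card * ℓ ^ 2)) := by gcongr
  linarith

end NearSquares

/-! ### From moduli back to palindromes -/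

/-- Numbers that are congruent modulo `q²`, close to each other and divisible by the square of some
`d ∈ [D, 2D]` are few. -/
theorem card_le_of_close_of_modEq {b j : ℕ} (hb : 2 ≤ b) {x D ℓ : ℝ} (hD : 1 ≤ D)
    (hxD : x ≤ D ^ 4) (hx : x ≤ D * ((b ^ j : ℕ) : ℝ) ^ 6) (hℓ1 : 1 ≤ ℓ)
    (hℓ : ∀ n : ℕ, (n : ℝ) ≤ (2 * b + 11) * x * ((b ^ j : ℕ) : ℝ) ^ 3 →
      ∑ i ∈ Icc 1 n, (i : ℝ)⁻¹ ≤ ℓ) (P : Finset ℕ) (hpos : ∀ n ∈ P, 0 < n)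
    (hle : ∀ n ∈ P, (n : ℝ) ≤ x) (hco : ∀ n ∈ P, Nat.Coprime n b)
    (hsq : ∀ n ∈ P, ∃ d : ℕ, (d : ℝ) ∈ Set.Icc D (2 * D) ∧ d ^ 2 ∣ n)
    (hclose : ∀ n ∈ P, ∀ n' ∈ P, ((n : ℝ) - n') * ((b ^ j : ℕ) : ℝ) ^ 2 ≤ b * x)
    (hmod : ∀ n ∈ P, ∀ n' ∈ P, ((b ^ j : ℕ) : ℤ) ^ 2 ∣ (n : ℤ) - n') :
    (P.card : ℝ) ≤ (b + 1) * ((3 + 36 * b * (10 * b + 46) + 4 * b ^ 2) *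
      (((b ^ j : ℕ) : ℝ) ^ 2 * (b ^ j).divisors.card * ℓ ^ 2)) := by
  classical
  choose! δ hδ hδn using hsq
  have hex : ∀ d ∈ P.image δ, ∃ n ∈ P, δ n = d := fun d hd => mem_image.1 hd
  choose! ν hνP hν using hex
  have hνeq : ∀ d ∈ P.image δ, d ^ 2 * (ν d / d ^ 2) = ν d := fun d hd => by
    have := hδn (ν d) (hνP d hd)
    rw [hν d hd] at this
    exact Nat.mul_div_cancel' this
  have hνR : ∀ d ∈ P.image δ, (d : ℝ) ^ 2 * ((ν d / d ^ 2 : ℕ) : ℝ) = ν d := fun d hd => by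
    exact_mod_cast hνeq d hd
  have hνZ : ∀ d ∈ P.image δ, (d : ℤ) ^ 2 * ((ν d / d ^ 2 : ℕ) : ℤ) = ν d := fun d hd => by
    exact_mod_cast hνeq d hd
  have hN : NearSquares b (b ^ j) x D (P.image δ) (fun d => ν d / d ^ 2) :=
    { range := fun d hd => by
        have := hδ (ν d) (hνP d hd)
        rwa [hν d hd] at this
      coprime := fun d hd => by rw [hνeq d hd]; exact hco _ (hνP d hd)
      le := fun d hd => by rw [hνR d hd]; exact hle _ (hνP d hd)
      close := fun d hd d' hd' => by
        rw [hνR d hd, hνR d' hd']; exact hclose _ (hνP d hd) _ (hνP d' hd')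
      modEq := fun d hd d' hd' => by
        rw [hνZ d hd, hνZ d' hd']; exact hmod _ (hνP d hd) _ (hνP d' hd') }
  have hcard := hN.card_le hb hD hx (fun d hd => Nat.pos_of_ne_zero fun h0 => by
    have h1 := hνeq d hd
    have h2 := hpos _ (hνP d hd)
    rw [h0, mul_zero] at h1
    omega) hℓ1 hℓ
  set q := b ^ j with hq
  have hq0 : 0 < q := by positivity
  have hqR : (0 : ℝ) < q := by exact_mod_cast hq0
  have hD0 : 0 < D := by linarith
  -- Two numbers with the same d differ by a multiple of d²q². The spread bx/q² allows b + 1 of them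
  -- because x ≤ D²q⁴, which follows from x ≤ D⁴ and x ≤ Dq⁶.
  have hfib : ∀ d ∈ P.image δ, (P.filter (δ · = d)).card ≤ b + 1 := by
    intro d hd
    have hd1 : D ≤ d := (hN.range d hd).1
    have hx0 : 0 ≤ x := le_trans (Nat.cast_nonneg _) (hle _ (hνP d hd))
    have hxDq : x ≤ D ^ 2 * (q : ℝ) ^ 4 := by
      refine le_of_pow_le_pow_left₀ (n := 3) (by norm_num) (by positivity) ?_
      calc x ^ 3 = x * (x * x) := by ring
        _ ≤ D ^ 4 * ((D * (q : ℝ) ^ 6) * (D * (q : ℝ) ^ 6)) := by gcongr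
        _ = _ := by ring
    have hdpos : (0 : ℝ) < d := hD0.trans_le hd1
    have := card_le_of_separated (P.filter (δ · = d)) (fun n : ℕ => (n : ℝ))
      (δ := (d : ℝ) ^ 2 * (q : ℝ) ^ 2) (W := b * x / (q : ℝ) ^ 2) (by positivity) (by positivity)
      (fun n hn n' hn' hne => by
        rw [mem_filter] at hn hn'
        have h1 : (d : ℤ) ^ 2 ∣ (n : ℤ) - n' := by
          refine dvd_sub ?_ ?_
          · have := hδn n hn.1
            rw [hn.2] at this
            exact_mod_cast this
          · have := hδn n' hn'.1
            rw [hn'.2] at this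
            exact_mod_cast this
        have h2 : IsCoprime ((d : ℤ) ^ 2) ((q : ℤ) ^ 2) := (hN.isCoprime hd).symm.pow
        have h3 : (d : ℤ) ^ 2 * (q : ℤ) ^ 2 ≤ |(n : ℤ) - n'| :=
          Int.le_of_dvd (abs_pos.2 (sub_ne_zero.2 (by exact_mod_cast hne)))
            ((dvd_abs _ _).2 (h2.mul_dvd h1 (hmod n hn.1 n' hn'.1)))
        exact_mod_cast h3)
      (fun n hn n' hn' => by
        rw [le_div_iff₀ (by positivity)]
        exact hclose n (mem_filter.1 hn).1 n' (mem_filter.1 hn').1)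
    have h1 : b * x / (q : ℝ) ^ 2 / ((d : ℝ) ^ 2 * (q : ℝ) ^ 2) ≤ b := by
      rw [div_div, div_le_iff₀ (by positivity)]
      calc b * x ≤ b * (D ^ 2 * (q : ℝ) ^ 4) := by gcongr
        _ ≤ b * ((d : ℝ) ^ 2 * (q : ℝ) ^ 4) := by gcongr
        _ = _ := by ring
    have h2 : ((P.filter (δ · = d)).card : ℝ) ≤ ((b + 1 : ℕ) : ℝ) := by push_cast; linarith
    exact_mod_cast h2
  have h1 : P.card ≤ (b + 1) * (P.image δ).card := card_le_mul_card_image P (b + 1) hfib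
  calc (P.card : ℝ) ≤ (b + 1) * (P.image δ).card := by exact_mod_cast h1
    _ ≤ _ := by gcongr

/-- Palindromes with the same number of digits and the same `k` leading digits are congruent modulo
`b ^ k` and close to each other. -/
theorem palindromes_close_of_leading_eq {b : ℕ} (hb : 2 ≤ b) {n n' k : ℕ} (hn : n ∈ palindromes b)
    (hn' : n' ∈ palindromes b) (hlen : (Nat.digits b n).length = (Nat.digits b n').length)
    (hlead : n / b ^ ((Nat.digits b n).length - k) = n' / b ^ ((Nat.digits b n').length - k)) :
    ((b ^ k : ℕ) : ℤ) ∣ (n : ℤ) - n' ∧ ((n : ℝ) - n') * ((b ^ k : ℕ) : ℝ) ≤ b * n := by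
  rcases le_total k (Nat.digits b n).length with hk | hk
  · constructor
    · refine Nat.modEq_iff_dvd.1 (?_ : n' % b ^ k = n % b ^ k)
      rw [palindromes_mod_pow hb hn hk, palindromes_mod_pow hb hn' (hlen ▸ hk), hlead]
    · set N := (Nat.digits b n).length with hN
      have hn0 : n ≠ 0 := by rintro rfl; exact hn.1 (dvd_zero b)
      have hpos : 0 < b ^ (N - k) := by positivity
      have h1 : n ≤ n' + b ^ (N - k) := by
        have a1 := Nat.div_add_mod n (b ^ (N - k))
        have a2 := Nat.div_mul_le_self n' (b ^ (N - k))
        rw [← hlen] at hlead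
        rw [← hlead, mul_comm] at a2
        have a3 := Nat.mod_lt n hpos
        omega
      have h2 : b ^ (N - k) * b ^ k ≤ b * n := by
        rw [← pow_add, Nat.sub_add_cancel hk]
        exact Nat.base_pow_length_digits_le b n hb hn0
      have h1R : (n : ℝ) - n' ≤ (b ^ (N - k) : ℕ) := by
        have : (n : ℝ) ≤ n' + (b ^ (N - k) : ℕ) := by exact_mod_cast h1
        linarith
      calc ((n : ℝ) - n') * ((b ^ k : ℕ) : ℝ) ≤ (b ^ (N - k) : ℕ) * ((b ^ k : ℕ) : ℝ) := by gcongr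
        _ ≤ b * n := by exact_mod_cast h2
  -- With at most k digits the truncated exponent is 0, so the leading part is the whole number and
  -- n = n'.
  · rw [← hlen, Nat.sub_eq_zero_of_le hk, pow_zero, Nat.div_one, Nat.div_one] at hlead
    subst hlead
    rw [sub_self, sub_self, zero_mul]
    exact ⟨dvd_zero _, by positivity⟩

/-- Length and the top 2j digits give at most (L + 1)q² groups, each with O(q²) members up to the
divisor and harmonic factors; hence q⁴. -/
theorem S_le {b j L : ℕ} (hb : 2 ≤ b) {x D ℓ : ℝ} (hD : 1 ≤ D) (hxD : x ≤ D ^ 4)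
    (hx : x ≤ D * ((b ^ j : ℕ) : ℝ) ^ 6) (hL : x < (b : ℝ) ^ L) (hℓ1 : 1 ≤ ℓ)
    (hℓ : ∀ n : ℕ, (n : ℝ) ≤ (2 * b + 11) * x * ((b ^ j : ℕ) : ℝ) ^ 3 →
      ∑ i ∈ Icc 1 n, (i : ℝ)⁻¹ ≤ ℓ) :
    (S b x D : ℝ) ≤ (b + 1) * (3 + 36 * b * (10 * b + 46) + 4 * b ^ 2) *
      ((L + 1) * (b ^ j).divisors.card * ℓ ^ 2 * ((b ^ j : ℕ) : ℝ) ^ 4) := by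
  classical
  set A := (squareDivSet_finite b x D).toFinset with hA
  have hmem : ∀ n ∈ A, n ∈ squareDivSet b x D := fun n hn => (Set.Finite.mem_toFinset _).1 hn
  have hpow : ((b ^ (2 * j) : ℕ) : ℤ) = ((b ^ j : ℕ) : ℤ) ^ 2 := by push_cast; ring
  have hpowR : ((b ^ (2 * j) : ℕ) : ℝ) = ((b ^ j : ℕ) : ℝ) ^ 2 := by push_cast; ring
  set key : ℕ → ℕ × ℕ := fun n =>
    ((Nat.digits b n).length, n / b ^ ((Nat.digits b n).length - 2 * j)) with hkey
  have hmaps : ∀ n ∈ A, key n ∈ range (L + 1) ×ˢ range (b ^ (2 * j)) := by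
    intro n hn
    obtain ⟨⟨-, hnx, -⟩, -⟩ := hmem n hn
    rw [mem_product, mem_range, mem_range]
    constructor
    · refine Nat.lt_succ_of_le ((Nat.digits_length_le_iff hb n).2 ?_)
      exact_mod_cast hnx.trans_lt hL
    · refine Nat.div_lt_of_lt_mul ?_
      rw [← pow_add]
      refine (Nat.lt_base_pow_length_digits hb).trans_le (Nat.pow_le_pow_right (by omega) ?_)
      omega
  have hfib : ∀ κ ∈ range (L + 1) ×ˢ range (b ^ (2 * j)), ((A.filter (key · = κ)).card : ℝ) ≤
      (b + 1) * ((3 + 36 * b * (10 * b + 46) + 4 * b ^ 2) *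
      (((b ^ j : ℕ) : ℝ) ^ 2 * (b ^ j).divisors.card * ℓ ^ 2)) := by
    intro κ _
    have hmem' : ∀ n ∈ A.filter (key · = κ), n ∈ squareDivSet b x D := fun n hn =>
      hmem n (mem_filter.1 hn).1
    have hpair : ∀ n ∈ A.filter (key · = κ), ∀ n' ∈ A.filter (key · = κ),
        ((b ^ (2 * j) : ℕ) : ℤ) ∣ (n : ℤ) - n' ∧
          ((n : ℝ) - n') * ((b ^ (2 * j) : ℕ) : ℝ) ≤ b * n := by
      intro n hn n' hn'
      have e : key n = key n' := (mem_filter.1 hn).2.trans (mem_filter.1 hn').2.symm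
      have e1 := Prod.ext_iff.1 e
      exact palindromes_close_of_leading_eq hb (hmem' n hn).1.1 (hmem' n' hn').1.1 e1.1 e1.2
    refine card_le_of_close_of_modEq hb hD hxD hx hℓ1 hℓ _ ?_ (fun n hn => (hmem' n hn).1.2.1) ?_
      (fun n hn => (hmem' n hn).2) ?_ ?_
    · intro n hn
      refine Nat.pos_of_ne_zero ?_
      rintro rfl
      exact (hmem' 0 hn).1.1.1 (dvd_zero b)
    · intro n hn
      refine Nat.Coprime.coprime_dvd_right ?_ (hmem' n hn).1.2.2
      exact Nat.dvd_sub (dvd_pow_self b (by norm_num)) dvd_rfl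
    · intro n hn n' hn'
      rw [← hpowR]
      refine (hpair n hn n' hn').2.trans ?_
      have := (hmem' n hn).1.2.1
      gcongr
    · intro n hn n' hn'
      rw [← hpow]
      exact (hpair n hn n' hn').1
  have hcard : (S b x D : ℝ) =
      ∑ κ ∈ range (L + 1) ×ˢ range (b ^ (2 * j)), ((A.filter (key · = κ)).card : ℝ) := by
    have h1 : S b x D = A.card := Set.ncard_eq_toFinset_card _ (squareDivSet_finite b x D)
    rw [h1, card_eq_sum_card_fiberwise hmaps]
    push_cast
    rfl
  rw [hcard]
  refine (sum_le_sum hfib).trans_eq ?_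
  rw [sum_const, card_product, card_range, card_range, nsmul_eq_mul, Nat.cast_mul, hpowR]
  push_cast
  ring

/-! ### Choice of q and logarithmic factors -/

/-- For fixed b the divisor count of b^j is polynomial in j, so it costs only a power of log x. -/
theorem card_divisors_pow_le {b : ℕ} (hb : 2 ≤ b) (j : ℕ) :
    (b ^ j).divisors.card ≤ (b * (j + 1)) ^ b.primeFactors.card := by
  rw [Nat.card_divisors (by positivity)]
  calc ∏ p ∈ (b ^ j).primeFactors, ((b ^ j).factorization p + 1)
      ≤ ∏ _p ∈ (b ^ j).primeFactors, (b * (j + 1)) := by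
        refine prod_le_prod' fun p _ => ?_
        have h1 : b.factorization p < b := Nat.factorization_lt p (by omega)
        rw [Nat.factorization_pow, Finsupp.smul_apply, smul_eq_mul]
        nlinarith
    _ = (b * (j + 1)) ^ (b ^ j).primeFactors.card := by rw [prod_const]
    _ ≤ (b * (j + 1)) ^ b.primeFactors.card := by
        refine Nat.pow_le_pow_right (by positivity) (card_le_card ?_)
        intro p hp
        have hp' := Nat.prime_of_mem_primeFactors hp
        exact Nat.mem_primeFactors.2
          ⟨hp', hp'.dvd_of_dvd_pow (Nat.dvd_of_mem_primeFactors hp), by omega⟩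

theorem sum_inv_le_one_add_log (n : ℕ) :
    ∑ i ∈ Icc 1 n, (i : ℝ)⁻¹ ≤ 1 + Real.log n := by
  have := harmonic_le_one_add_log n
  rw [harmonic_eq_sum_Icc] at this
  push_cast at this
  exact this

theorem le_two_mul_log_of_pow_le {b k : ℕ} (hb : 2 ≤ b) {y : ℝ} (h : (b : ℝ) ^ k ≤ y) :
    (k : ℝ) ≤ 2 * Real.log y := by
  have hb2 : (2 : ℝ) ≤ b := by exact_mod_cast hb
  have h1 : (2 : ℝ) ^ k ≤ y := (by gcongr : (2 : ℝ) ^ k ≤ (b : ℝ) ^ k).trans h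
  have h2 := Real.log_le_log (by positivity) h1
  rw [Real.log_pow] at h2
  have h3 : (1 / 2 : ℝ) ≤ Real.log 2 := by linarith [Real.log_two_gt_d9]
  have h4 : (k : ℝ) * (1 / 2) ≤ k * Real.log 2 := by gcongr
  linarith

/-- The bound for `S b x D` up to powers of `log x`. -/
theorem exists_S_le_log_pow {b : ℕ} (hb : 2 ≤ b) : ∃ C : ℝ, 0 < C ∧ ∀ x D : ℝ, 1 ≤ x → 1 ≤ D →
    x ≤ D ^ 4 → D ≤ x → (S b x D : ℝ) ≤
      C * (1 + Real.log x) ^ (b.primeFactors.card + 3) * (x / D) ^ (2 / 3 : ℝ) := by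
  set k := b.primeFactors.card with hk
  set c : ℝ := Real.log ((2 * b + 11) * b ^ 6) with hc
  have hb2 : (2 : ℝ) ≤ b := by exact_mod_cast hb
  have hb6 : (1 : ℝ) ≤ (b : ℝ) ^ 6 := one_le_pow₀ (by linarith)
  have hc0 : 0 ≤ c := Real.log_nonneg (by nlinarith)
  refine ⟨(b + 1) * (3 + 36 * b * (10 * b + 46) + 4 * b ^ 2) *
    (4 * (b * (2 * c + 3)) ^ k * (c + 2) ^ 2 * b ^ 4), by positivity, ?_⟩
  intro x D hx hD hxD hDx
  have hD0 : 0 < D := by linarith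
  have hlog : 0 ≤ Real.log x := Real.log_nonneg hx
  -- Here b^(6i) ≤ x/D < b^(6(i+1)). Taking j = i + 1 puts q⁶ between x/D and b⁶·x/D.
  obtain ⟨i, hi1, hi2⟩ := exists_nat_pow_near ((one_le_div hD0).2 hDx)
    (one_lt_pow₀ (by linarith : (1 : ℝ) < b) (by norm_num : 6 ≠ 0))
  obtain ⟨M, hM1, hM2⟩ := exists_nat_pow_near hx (by linarith : (1 : ℝ) < b)
  set q : ℝ := ((b ^ (i + 1) : ℕ) : ℝ) with hq
  have hqb : q = (b : ℝ) ^ (i + 1) := by rw [hq]; push_cast; ring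
  have hq0 : 0 < q := by rw [hqb]; positivity
  have hq1 : 1 ≤ q := by rw [hqb]; exact one_le_pow₀ (by linarith)
  have hq6 : q ^ 6 = ((b : ℝ) ^ 6) ^ (i + 1) := by rw [hqb]; ring
  have hqx : x ≤ D * q ^ 6 := by
    rw [hq6]
    rw [div_lt_iff₀ hD0] at hi2
    linarith
  have hqu : q ^ 6 ≤ b ^ 6 * (x / D) := by
    rw [hq6, pow_succ, mul_comm]
    gcongr
  have hxDx : x / D ≤ x := div_le_self (by linarith) hD
  have hqux : q ^ 6 ≤ b ^ 6 * x := hqu.trans (by gcongr)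
  set ℓ : ℝ := (c + 2) * (1 + Real.log x) with hℓ
  have hℓ1 : 1 ≤ ℓ := by nlinarith
  have hℓb : ∀ n : ℕ, (n : ℝ) ≤ (2 * b + 11) * x * q ^ 3 → ∑ i ∈ Icc 1 n, (i : ℝ)⁻¹ ≤ ℓ := by
    intro n hn
    rcases Nat.eq_zero_or_pos n with rfl | hn0
    · simp only [zero_lt_one, Icc_eq_empty_of_lt, sum_empty]; linarith
    have h1 : (n : ℝ) ≤ ((2 * b + 11) * b ^ 6) * (x * x) := by
      calc (n : ℝ) ≤ (2 * b + 11) * x * q ^ 3 := hn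
        _ ≤ (2 * b + 11) * x * q ^ 6 := by
          gcongr
          norm_num
        _ ≤ (2 * b + 11) * x * (b ^ 6 * x) := by gcongr
        _ = _ := by ring
    have h2 := Real.log_le_log (by exact_mod_cast hn0) h1
    rw [Real.log_mul (x := (2 * b + 11) * b ^ 6) (by positivity) (by positivity), ← hc,
      Real.log_mul (by positivity) (by positivity)] at h2
    have h3 := sum_inv_le_one_add_log n
    have h4 : 0 ≤ c * Real.log x := by positivity
    rw [hℓ]
    linarith
  have hS := S_le (j := i + 1) (L := M + 1) hb hD hxD hqx (by exact_mod_cast hM2) hℓ1 hℓb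
  have hMl : ((M + 1 : ℕ) : ℝ) + 1 ≤ 4 * (1 + Real.log x) := by
    have := le_two_mul_log_of_pow_le hb hM1
    push_cast
    linarith
  have hil : ((i + 1 : ℕ) : ℝ) + 1 ≤ (2 * c + 3) * (1 + Real.log x) := by
    have h0 : (b : ℝ) ^ (i + 1) ≤ ((2 * b + 11) * b ^ 6) * x := by
      rw [← hqb]
      calc q = q ^ 1 := (pow_one q).symm
        _ ≤ q ^ 6 := pow_le_pow_right₀ hq1 (by norm_num)
        _ ≤ 1 * b ^ 6 * x := by rw [one_mul]; exact hqux
        _ ≤ _ := by gcongr; linarith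
    have h1 := le_two_mul_log_of_pow_le hb h0
    rw [Real.log_mul (by positivity) (by positivity), ← hc] at h1
    have h2 : 0 ≤ c * Real.log x := by positivity
    linarith
  have hτ : ((b ^ (i + 1)).divisors.card : ℝ) ≤ (b * (2 * c + 3)) ^ k * (1 + Real.log x) ^ k := by
    calc ((b ^ (i + 1)).divisors.card : ℝ) ≤ (((b * (i + 1 + 1)) ^ k : ℕ) : ℝ) := by
          exact_mod_cast card_divisors_pow_le hb (i + 1)
      _ = (b * (((i + 1 : ℕ) : ℝ) + 1)) ^ k := by push_cast; ring
      _ ≤ (b * ((2 * c + 3) * (1 + Real.log x))) ^ k := by gcongr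
      _ = _ := by rw [← mul_assoc, mul_pow]
  have hq4 : q ^ 4 ≤ b ^ 4 * (x / D) ^ (2 / 3 : ℝ) := by
    have hxD0 : 0 ≤ x / D := by positivity
    have h1 : (q ^ 6) ^ (2 / 3 : ℝ) ≤ (b ^ 6 * (x / D)) ^ (2 / 3 : ℝ) :=
      Real.rpow_le_rpow (by positivity) hqu (by norm_num)
    rw [Real.mul_rpow (by positivity) hxD0, ← Real.rpow_natCast, ← Real.rpow_natCast,
      ← Real.rpow_mul hq0.le, ← Real.rpow_mul (by positivity)] at h1
    have e : ((6 : ℕ) : ℝ) * (2 / 3) = ((4 : ℕ) : ℝ) := by norm_num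
    rwa [e, Real.rpow_natCast, Real.rpow_natCast] at h1
  have hΛ : (0 : ℝ) ≤ 1 + Real.log x := by linarith
  calc (S b x D : ℝ) ≤ (b + 1) * (3 + 36 * b * (10 * b + 46) + 4 * b ^ 2) *
      ((((M + 1 : ℕ) : ℝ) + 1) * (b ^ (i + 1)).divisors.card * ℓ ^ 2 * q ^ 4) := hS
    _ ≤ (b + 1) * (3 + 36 * b * (10 * b + 46) + 4 * b ^ 2) *
      ((4 * (1 + Real.log x)) * ((b * (2 * c + 3)) ^ k * (1 + Real.log x) ^ k) *
        ((c + 2) * (1 + Real.log x)) ^ 2 * (b ^ 4 * (x / D) ^ (2 / 3 : ℝ))) := by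
      gcongr
    _ = _ := by ring

theorem exists_one_add_log_pow_le (k : ℕ) {ε : ℝ} (hε : 0 < ε) : ∃ C : ℝ, 0 < C ∧
    ∀ x D : ℝ, 1 ≤ x → 1 ≤ D → x ≤ D ^ 4 → (1 + Real.log x) ^ (k + 1) ≤ C * D ^ ε := by
  -- Each of the k + 1 logarithms receives an equal share of the exponent ε.
  set δ : ℝ := ε / ((k + 1 : ℕ) : ℝ) with hδ
  have hδ0 : 0 < δ := by positivity
  refine ⟨(1 + 4 / δ) ^ (k + 1), by positivity, fun x D hx hD hxD => ?_⟩
  have hD0 : 0 < D := by linarith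
  have h1 : Real.log x ≤ 4 * Real.log D := by
    have := Real.log_le_log (by linarith) hxD
    rwa [Real.log_pow] at this
  have h2 : Real.log D ≤ D ^ δ / δ := Real.log_le_rpow_div hD0.le hδ0
  have h3 : 1 ≤ D ^ δ := Real.one_le_rpow hD hδ0.le
  have h4 : 1 + Real.log x ≤ (1 + 4 / δ) * D ^ δ := by
    have e : (1 + 4 / δ) * D ^ δ = D ^ δ + 4 * (D ^ δ / δ) := by ring
    rw [e]
    linarith
  have h5 : 0 ≤ Real.log x := Real.log_nonneg hx
  calc (1 + Real.log x) ^ (k + 1) ≤ ((1 + 4 / δ) * D ^ δ) ^ (k + 1) := by gcongr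
    _ = (1 + 4 / δ) ^ (k + 1) * D ^ ε := by
      rw [mul_pow, ← Real.rpow_natCast (D ^ δ), ← Real.rpow_mul hD0.le, hδ,
        div_mul_cancel₀ _ (by positivity)]

theorem S_eq_zero_of_lt_one (b : ℕ) {x : ℝ} (D : ℝ) (hx : x < 1) : S b x D = 0 := by
  have : squareDivSet b x D = ∅ := by
    refine Set.eq_empty_of_forall_notMem fun n hn => ?_
    have h1 : (n : ℝ) < 1 := hn.1.2.1.trans_lt hx
    have h2 : n = 0 := by
      have : n < 1 := by exact_mod_cast h1
      omega
    subst h2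
    exact hn.1.1.1 (dvd_zero b)
  rw [S, this, Set.ncard_empty]

theorem exists_S_le {b : ℕ} (hb : 2 ≤ b) {ε : ℝ} (hε : 0 < ε) : ∃ C : ℝ, 0 < C ∧
    ∀ x D : ℝ, 0 < x → x ^ (1 / 4 : ℝ) ≤ D → D ≤ x ^ (2 / 5 : ℝ) →
      (S b x D : ℝ) ≤ C * (x ^ (2 / 3 : ℝ) / D ^ (2 / 3 - ε)) := by
  obtain ⟨C₁, hC₁, h₁⟩ := exists_S_le_log_pow hb
  obtain ⟨C₂, hC₂, h₂⟩ := exists_one_add_log_pow_le (b.primeFactors.card + 2) hε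
  refine ⟨C₁ * C₂, by positivity, fun x D hx hxD hDx => ?_⟩
  have hD0 : 0 < D := (Real.rpow_pos_of_pos hx _).trans_le hxD
  rcases lt_or_ge x 1 with hx1 | hx1
  · rw [S_eq_zero_of_lt_one b D hx1, Nat.cast_zero]
    positivity
  have hD1 : 1 ≤ D := (Real.one_le_rpow hx1 (by norm_num)).trans hxD
  have hxD4 : x ≤ D ^ 4 := by
    calc x = (x ^ (1 / 4 : ℝ)) ^ 4 := by
          rw [← Real.rpow_natCast, ← Real.rpow_mul hx.le]
          norm_num
      _ ≤ D ^ 4 := by gcongr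
  have hDx1 : D ≤ x := hDx.trans (by
    simpa using Real.rpow_le_rpow_of_exponent_le hx1 (by norm_num : (2 / 5 : ℝ) ≤ 1))
  calc (S b x D : ℝ)
      ≤ C₁ * (1 + Real.log x) ^ (b.primeFactors.card + 3) * (x / D) ^ (2 / 3 : ℝ) :=
        h₁ x D hx1 hD1 hxD4 hDx1
    _ ≤ C₁ * (C₂ * D ^ ε) * (x / D) ^ (2 / 3 : ℝ) := by
        gcongr
        exact h₂ x D hx1 hD1 hxD4
    _ = C₁ * C₂ * (x ^ (2 / 3 : ℝ) / D ^ (2 / 3 - ε)) := by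
        rw [Real.div_rpow hx.le hD0.le, Real.rpow_sub hD0]
        field_simp

end SqfreePalin

theorem proposition2p3 (b : ℕ) (hb : 2 ≤ b) :
    (∀ ε : ℝ, 0 < ε → ∃ C : ℝ, 0 < C ∧ ∀ x D : ℝ, 0 < x →
      x ^ (1 / 4 : ℝ) ≤ D → D ≤ x ^ (2 / 5 : ℝ) →
        (SqfreePalin.S b x D : ℝ) ≤ C * (x ^ (2 / 3 : ℝ) / D ^ (2 / 3 - ε))) ∧
    (∀ ε : ℝ, 0 < ε → ε < 1 / 4 → ∃ C : ℝ, 0 < C ∧ ∀ x D : ℝ, 0 < x →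
      x ^ (1 / 4 + 3 * ε) ≤ D → D ≤ x ^ (2 / 5 : ℝ) →
        (SqfreePalin.S b x D : ℝ) ≤ C * x ^ (1 / 2 - ε)) := by
  refine ⟨fun ε hε => SqfreePalin.exists_S_le hb hε, fun ε hε hε4 => ?_⟩
  obtain ⟨C, hC, h⟩ := SqfreePalin.exists_S_le hb hε
  refine ⟨C, hC, fun x D hx hxD hDx => ?_⟩
  rcases lt_or_ge x 1 with hx1 | hx1
  · rw [SqfreePalin.S_eq_zero_of_lt_one b D hx1, Nat.cast_zero]
    positivity
  have hxD' : x ^ (1 / 4 : ℝ) ≤ D :=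
    (Real.rpow_le_rpow_of_exponent_le hx1 (by linarith)).trans hxD
  refine (h x D hx hxD' hDx).trans (mul_le_mul_of_nonneg_left ?_ hC.le)
  have h1 : (x ^ (1 / 4 + 3 * ε)) ^ (2 / 3 - ε) ≤ D ^ (2 / 3 - ε) :=
    Real.rpow_le_rpow (by positivity) hxD (by linarith)
  rw [← Real.rpow_mul hx.le] at h1
  calc x ^ (2 / 3 : ℝ) / D ^ (2 / 3 - ε)
      ≤ x ^ (2 / 3 : ℝ) / x ^ ((1 / 4 + 3 * ε) * (2 / 3 - ε)) := by gcongr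
    _ = x ^ (2 / 3 - (1 / 4 + 3 * ε) * (2 / 3 - ε)) := (Real.rpow_sub hx _ _).symm
    _ ≤ x ^ (1 / 2 - ε) := by
        refine Real.rpow_le_rpow_of_exponent_le hx1 ?_
        -- The exponent on the left is 1/2 − 7ε/4 + 3ε², which is at most 1/2 − ε because ε < 1/4.
        nlinarith
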